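/- Let $0<q<1$ and let $n\ge 2$ be an integer. Let $A=C(SU_q(2))$ be the universal unital $C^*$-algebra generated by two elements $\alpha,\beta$ with the relations $$\alpha^*\alpha+\beta^*\beta=1,\quad \alpha\alpha^*+q^2\beta\beta^*=1,\quad \alpha\beta=q\beta\alpha,\quad \alpha\beta^*=q\beta^*\alpha,\quad \beta^*\beta=\beta\beta^*,$$ and let $\Delta:A\to A\otimes A$ be the unital $*$-homomorphism with $$\Delta(\alpha)=\alpha\otimes\alpha-q\,\beta^*\otimes\beta,\qquad \Delta(\beta)=\beta\otimes\alpha+\alpha^*\otimes\beta .$$ Here and below $\otimes$, between $C^*$-algebras, is the minimal tensor product. Let $(e_k)_{k\ge 0}$ be the standard basis of $\ell^2(\mathbb N_0)$, let $p_k$ be the projection onto $\mathbb C e_k$, and put $Qe_k=q^ke_k$, $Se_k=e_{k-1}$ for $k>0$, $Se_0=0$. On $L^2(\mathbb R)$ let $(R\xi)(x)=e^{2\pi i x}\xi(x)$ and $(R^{1/n}\xi)(x)=e^{2\pi i x/n}\xi(x)$. Represent $A$ on $\ell^2(\mathbb N_0)\otimes L^2(\mathbb R)$ by $$\alpha\mapsto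 S\sqrt{1-Q^2}\otimes 1,\qquad \beta\mapsto Q\otimes R .$$ Put $\widetilde\beta=\sum_{k\ge 0}q^{k/n}\,p_k\otimes R^{1/n}$, so that $\widetilde\beta^{\,n}=\beta$, and let $\widetilde A=C(SU_q(2))[\widetilde\beta]$ be the $C^*$-algebra of operators on $\ell^2(\mathbb N_0)\otimes L^2(\mathbb R)$ generated by the image of $A$ and by $\widetilde\beta$. The group $\mathbb Z_n=\mathbb Z/n\mathbb Z$ acts on $\widetilde A$ by the $*$-automorphisms with $$\overline m\,(a\widetilde\beta^{\,k})=e^{2\pi i mk/n}\,a\widetilde\beta^{\,k}\qquad(a\in A,\ k\ge 0),$$ which are implemented by the translations $\xi(x)\mapsto\xi(x+m)$ of $L^2(\mathbb R)$. A compact quantum group structure on a unital $C^*$-algebra $B$ is a unital $*$-homomorphism $\Delta_B:B\to B\otimes B$ such that $(\Delta_B\otimes\mathrm{id})\Delta_B=(\mathrm{id}\otimes\Delta_B)\Delta_B$, and such that the linear spans of $\{(a\otimes 1)\Delta_B(b): a,b\in B\}$ and of $\{(1\otimes a)\Delta_B(b): a,b\in B\}$ are dense in $B\otimes B$. Then there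 is no compact quantum group structure $\widetilde\Delta$ on $\widetilde A$ with the following two properties: (i) $\widetilde\Delta$ extends $\Delta$, that is, $\widetilde\Delta(a)=\Delta(a)$ for all $a\in A$, where $A\otimes A$ is mapped to $\widetilde A\otimes\widetilde A$ by the inclusion of $A$ in $\widetilde A$ in both factors; (ii) $\widetilde\Delta$ is $\mathbb Z_n$-equivariant, that is, $\widetilde\Delta(g x)=(g\otimes g)\,\widetilde\Delta(x)$ for all $g\in\mathbb Z_n$ and $x\in\widetilde A$. -/

import Mathlib

open scoped TensorProduct

noncomputable section

/-- A C⋆-seminorm on a unital complex ⋆-algebra. -/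
structure CStarSeminorm (R : Type*) [Ring R] [Algebra ℂ R] [StarRing R] extends
    Seminorm ℂ R where
  mul_le' : ∀ x y, toFun (x * y) ≤ toFun x * toFun y
  star_mul_self' : ∀ x, toFun (star x * x) = toFun x * toFun x

namespace CStarSeminorm

variable {R : Type*} [Ring R] [Algebra ℂ R] [StarRing R]

instance : FunLike (CStarSeminorm R) R ℝ where
  coe p := p.toFun
  coe_injective p p' h := by
    rcases p with ⟨p, _, _⟩
    rcases p' with ⟨p', _, _⟩
    have : p = p' := DFunLike.coe_injective h
    subst this
    rfl

lemma mul_le (p : CStarSeminorm R) (x y : R) : p (x * y) ≤ p x * p y := p.mul_le' x y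

lemma star_mul_self (p : CStarSeminorm R) (x : R) : p (star x * x) = p x * p x :=
  p.star_mul_self' x

lemma add_le (p : CStarSeminorm R) (x y : R) : p (x + y) ≤ p x + p y := p.add_le' x y

lemma smul_eq (p : CStarSeminorm R) (c : ℂ) (x : R) : p (c • x) = ‖c‖ * p x := p.smul' c x

lemma nonneg (p : CStarSeminorm R) (x : R) : 0 ≤ p x := apply_nonneg p.toSeminorm x

lemma neg_eq (p : CStarSeminorm R) (x : R) : p (-x) = p x := p.neg' x

lemma zero_eq (p : CStarSeminorm R) : p 0 = 0 := p.map_zero'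

lemma le_star (p : CStarSeminorm R) (x : R) : p x ≤ p (star x) := by
  rcases (p.nonneg x).eq_or_lt with h | h
  · rw [← h]; exact p.nonneg _
  · have := p.mul_le (star x) x
    rw [p.star_mul_self] at this
    exact le_of_mul_le_mul_right this h

lemma star_eq (p : CStarSeminorm R) (x : R) : p (star x) = p x :=
  le_antisymm (by simpa using p.le_star (star x)) (p.le_star x)

/-- The C⋆-seminorm `x ↦ ‖φ x‖` given by a ⋆-homomorphism into a C⋆-algebra. -/
def ofHom {B : Type*} [CStarAlgebra B] (φ : R →⋆ₐ[ℂ] B) : CStarSeminorm R where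
  toFun x := ‖φ x‖
  map_zero' := by simp
  add_le' x y := by simpa using norm_add_le _ _
  neg' x := by simp
  smul' c x := by simp [norm_smul]
  mul_le' x y := by simpa using norm_mul_le _ _
  star_mul_self' x := by simpa [map_star] using CStarRing.norm_star_mul_self

/-- The pointwise supremum of a pointwise bounded set of C⋆-seminorms. -/
def sup (S : Set (CStarSeminorm R)) (hS : ∀ x, BddAbove ((fun p : CStarSeminorm R => p x) '' S)) :
    CStarSeminorm R :=
  have le : ∀ (p) (_ : p ∈ S) (x : R), p x ≤ sSup ((fun p : CStarSeminorm R => p x) '' S) :=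
    fun p hp x => le_csSup (hS x) ⟨p, hp, rfl⟩
  have nn : ∀ x : R, 0 ≤ sSup ((fun p : CStarSeminorm R => p x) '' S) := fun x =>
    Real.sSup_nonneg (by rintro _ ⟨p, _, rfl⟩; exact p.nonneg x)
  { toFun := fun x => sSup ((fun p : CStarSeminorm R => p x) '' S)
    map_zero' := le_antisymm
      (Real.sSup_le (by rintro _ ⟨p, _, rfl⟩; exact p.zero_eq.le) le_rfl) (nn 0)
    add_le' := fun x y => Real.sSup_le (by
      rintro _ ⟨p, hp, rfl⟩
      exact (p.add_le x y).trans (add_le_add (le p hp x) (le p hp y))) (add_nonneg (nn x) (nn y))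
    neg' := fun x => by simp only [neg_eq]
    smul' := fun c x => by
      rw [← smul_eq_mul, ← Real.sSup_smul_of_nonneg (norm_nonneg c), ← Set.image_smul,
        Set.image_image]
      simp only [smul_eq, smul_eq_mul]
    mul_le' := fun x y => Real.sSup_le (by
      rintro _ ⟨p, hp, rfl⟩
      exact (p.mul_le x y).trans (mul_le_mul (le p hp x) (le p hp y) (p.nonneg y) (nn x)))
      (mul_nonneg (nn x) (nn y))
    star_mul_self' := fun x => by
      apply le_antisymm
      · refine Real.sSup_le ?_ (mul_nonneg (nn x) (nn x))
        rintro _ ⟨p, hp, rfl⟩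
        simp only [star_mul_self]
        exact mul_le_mul (le p hp x) (le p hp x) (p.nonneg x) (nn x)
      · have h : sSup ((fun p : CStarSeminorm R => p x) '' S) ≤
            √(sSup ((fun p : CStarSeminorm R => p (star x * x)) '' S)) := by
          refine Real.sSup_le ?_ (Real.sqrt_nonneg _)
          rintro _ ⟨p, hp, rfl⟩
          refine Real.le_sqrt_of_sq_le ?_
          rw [sq]
          exact (p.star_mul_self x).symm.le.trans (le p hp (star x * x))
        exact (mul_self_le_mul_self (nn x) h).trans_eq (Real.mul_self_sqrt (nn _)) }

lemma le_sup {S : Set (CStarSeminorm R)}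
    (hS : ∀ x, BddAbove ((fun p : CStarSeminorm R => p x) '' S)) {p : CStarSeminorm R}
    (hp : p ∈ S) (x : R) : p x ≤ sup S hS x :=
  le_csSup (hS x) ⟨p, hp, rfl⟩

lemma sup_le {S : Set (CStarSeminorm R)}
    (hS : ∀ x, BddAbove ((fun p : CStarSeminorm R => p x) '' S)) {x : R} {c : ℝ}
    (hc : 0 ≤ c) (h : ∀ p ∈ S, p x ≤ c) : sup S hS x ≤ c :=
  Real.sSup_le (by rintro _ ⟨p, hp, rfl⟩; exact h p hp) hc

/-- The ⋆-algebra `R`, regarded as a seminormed algebra with seminorm `p`. -/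
def Pre (_ : CStarSeminorm R) : Type _ := R

variable (p : CStarSeminorm R)

instance : Ring p.Pre := inferInstanceAs (Ring R)
instance : Algebra ℂ p.Pre := inferInstanceAs (Algebra ℂ R)
instance : StarRing p.Pre := inferInstanceAs (StarRing R)
instance [StarModule ℂ R] : StarModule ℂ p.Pre := inferInstanceAs (StarModule ℂ R)

instance : SeminormedAddCommGroup p.Pre :=
  AddGroupSeminorm.toSeminormedAddCommGroup (E := p.Pre) p.toSeminorm.toAddGroupSeminorm

instance : SeminormedRing p.Pre where
  __ := (inferInstance : Ring p.Pre)
  __ := (inferInstance : SeminormedAddCommGroup p.Pre)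
  norm_mul_le := p.mul_le

lemma norm_pre (x : p.Pre) : ‖x‖ = p x := rfl

instance : NormedAlgebra ℂ p.Pre where
  norm_smul_le c x := (p.smul_eq c x).le

instance : NormedStarGroup p.Pre where
  norm_star_le x := (p.star_eq x).le

/-- The C⋆-algebra obtained from `R` by separation and completion with respect to `p`. -/
def Compl : Type _ := UniformSpace.Completion p.Pre

namespace Compl

instance : NormedRing p.Compl := inferInstanceAs (NormedRing (UniformSpace.Completion p.Pre))
instance : CompleteSpace p.Compl :=
  inferInstanceAs (CompleteSpace (UniformSpace.Completion p.Pre))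
instance : Algebra ℂ p.Compl := inferInstanceAs (Algebra ℂ (UniformSpace.Completion p.Pre))

instance : NormedAlgebra ℂ p.Compl where
  norm_smul_le c x := norm_smul_le (β := UniformSpace.Completion p.Pre) c x

/-- The canonical algebra homomorphism of `R` into the completion. -/
def coeAlg : R →ₐ[ℂ] p.Compl where
  toFun x := ((show p.Pre from x : p.Pre) : UniformSpace.Completion p.Pre)
  map_one' := UniformSpace.Completion.coe_one p.Pre
  map_mul' x y := UniformSpace.Completion.coe_mul (α := p.Pre) x y
  map_zero' := UniformSpace.Completion.coe_zero
  map_add' x y := UniformSpace.Completion.coe_add (α := p.Pre) x y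
  commutes' _ := rfl

lemma norm_coeAlg (x : R) : ‖coeAlg p x‖ = p x :=
  UniformSpace.Completion.norm_coe (E := p.Pre) x

lemma denseRange_coeAlg : DenseRange (coeAlg p) :=
  UniformSpace.Completion.denseRange_coe (α := p.Pre)

lemma induction_on {P : p.Compl → Prop} (x : p.Compl) (hc : IsClosed {x | P x})
    (h : ∀ x, P (coeAlg p x)) : P x :=
  (denseRange_coeAlg p).induction_on x hc h

/-- The isometric extension of the involution to the completion. -/
def starMap : UniformSpace.Completion p.Pre → UniformSpace.Completion p.Pre :=
  UniformSpace.Completion.map star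

lemma continuous_starMap : Continuous (starMap p) := UniformSpace.Completion.continuous_map

lemma starMap_coe (x : p.Pre) : starMap p x = ((star x : p.Pre) : UniformSpace.Completion p.Pre) :=
  UniformSpace.Completion.map_coe star_isometry.uniformContinuous x

instance : Star p.Compl := ⟨starMap p⟩

lemma star_coeAlg (x : R) : star (coeAlg p x) = coeAlg p (star x) := starMap_coe p x

lemma continuous_star' : Continuous (star : p.Compl → p.Compl) := continuous_starMap p

instance : StarRing p.Compl where
  star_involutive x := by
    have := continuous_star' p
    induction x using induction_on with
    | hc => exact isClosed_eq (by fun_prop) (by fun_prop)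
    | h x => simp [star_coeAlg]
  star_mul x y := by
    have := continuous_star' p
    induction x using induction_on with
    | hc => exact isClosed_eq (by fun_prop) (by fun_prop)
    | h x =>
      induction y using induction_on with
      | hc => exact isClosed_eq (by fun_prop) (by fun_prop)
      | h y => simp [star_coeAlg, ← map_mul]
  star_add x y := by
    have := continuous_star' p
    induction x using induction_on with
    | hc => exact isClosed_eq (by fun_prop) (by fun_prop)
    | h x =>
      induction y using induction_on with
      | hc => exact isClosed_eq (by fun_prop) (by fun_prop)
      | h y => simp [star_coeAlg, ← map_add]

instance : CStarRing p.Compl where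
  norm_mul_self_le x := by
    have := continuous_star' p
    induction x using induction_on with
    | hc => exact isClosed_le (by fun_prop) (by fun_prop)
    | h x => rw [star_coeAlg, ← map_mul, norm_coeAlg, norm_coeAlg, p.star_mul_self]

instance [StarModule ℂ R] : StarModule ℂ p.Compl where
  star_smul c x := by
    induction x using induction_on with
    | hc =>
      exact isClosed_eq ((continuous_star' p).comp (continuous_const_smul c))
        ((continuous_star' p).const_smul (star c))
    | h x => rw [← map_smul, star_coeAlg, star_smul, map_smul, star_coeAlg]

instance [StarModule ℂ R] : CStarAlgebra p.Compl where

/-- The canonical ⋆-homomorphism of `R` into the completion. -/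
def coe : R →⋆ₐ[ℂ] p.Compl where
  __ := coeAlg p
  map_star' x := (star_coeAlg p x).symm

lemma norm_coe (x : R) : ‖coe p x‖ = p x := norm_coeAlg p x

lemma denseRange_coe : DenseRange (coe p) := denseRange_coeAlg p

variable {B : Type*} [CStarAlgebra B]

/-- A ⋆-homomorphism, regarded as a ring homomorphism on the seminormed algebra. -/
def preHom (φ : R →⋆ₐ[ℂ] B) : p.Pre →+* B :=
  let f : R →+* B := ((φ : R →ₐ[ℂ] B) : R →+* B)
  f

variable {p} in
lemma continuous_preHom {φ : R →⋆ₐ[ℂ] B} (hφ : ∀ x, ‖φ x‖ ≤ p x) : Continuous (preHom p φ) :=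
  (AddMonoidHomClass.lipschitz_of_bound (preHom p φ) 1
    (fun x => by simpa using! hφ x)).continuous

/-- The extension to the completion of a ⋆-homomorphism that is bounded by the seminorm. -/
def lift [StarModule ℂ R] (φ : R →⋆ₐ[ℂ] B) (hφ : ∀ x, ‖φ x‖ ≤ p x) : p.Compl →⋆ₐ[ℂ] B :=
  let F : UniformSpace.Completion p.Pre →+* B :=
    UniformSpace.Completion.extensionHom (preHom p φ) (continuous_preHom hφ)
  have hF : ∀ x : p.Pre, F x = preHom p φ x :=
    UniformSpace.Completion.extensionHom_coe (preHom p φ) (continuous_preHom hφ)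
  have hc : Continuous F := UniformSpace.Completion.continuous_extension
  { toFun := F
    map_one' := map_one F
    map_mul' := map_mul F
    map_zero' := map_zero F
    map_add' := map_add F
    commutes' := fun c => (hF (algebraMap ℂ p.Pre c)).trans (AlgHomClass.commutes φ c)
    map_star' := fun x => by
      induction x using induction_on with
      | hc => exact isClosed_eq (hc.comp (continuous_star' p)) (continuous_star.comp hc)
      | h x =>
        rw [star_coeAlg]
        exact (hF (star x)).trans ((map_star φ x).trans (congrArg star (hF x).symm)) }

lemma lift_coe [StarModule ℂ R] (φ : R →⋆ₐ[ℂ] B) (hφ : ∀ x, ‖φ x‖ ≤ p x) (x : R) :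
    lift p φ hφ (coe p x) = φ x :=
  UniformSpace.Completion.extensionHom_coe (preHom p φ) (continuous_preHom hφ) x

end Compl

end CStarSeminorm

/-- The Hilbert space tensor product. -/
def HilbertTensor (H K : Type*) [NormedAddCommGroup H] [InnerProductSpace ℂ H]
    [NormedAddCommGroup K] [InnerProductSpace ℂ K] : Type _ :=
  UniformSpace.Completion (H ⊗[ℂ] K)

section OpTensor

variable {H K : Type*} [NormedAddCommGroup H] [InnerProductSpace ℂ H]
  [NormedAddCommGroup K] [InnerProductSpace ℂ K]

instance : NormedAddCommGroup (HilbertTensor H K) :=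
  inferInstanceAs (NormedAddCommGroup (UniformSpace.Completion (H ⊗[ℂ] K)))
instance : InnerProductSpace ℂ (HilbertTensor H K) :=
  inferInstanceAs (InnerProductSpace ℂ (UniformSpace.Completion (H ⊗[ℂ] K)))
instance : CompleteSpace (HilbertTensor H K) :=
  inferInstanceAs (CompleteSpace (UniformSpace.Completion (H ⊗[ℂ] K)))

/-- The isometric embedding of the algebraic tensor product. -/
def HilbertTensor.coe : H ⊗[ℂ] K →ₗᵢ[ℂ] HilbertTensor H K :=
  UniformSpace.Completion.toComplₗᵢ (𝕜 := ℂ) (E := H ⊗[ℂ] K)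

lemma HilbertTensor.denseRange_coe : DenseRange (HilbertTensor.coe : H ⊗[ℂ] K → _) :=
  UniformSpace.Completion.denseRange_coe (α := H ⊗[ℂ] K)

lemma HilbertTensor.induction_on {P : HilbertTensor H K → Prop} (x : HilbertTensor H K)
    (hc : IsClosed {x | P x}) (h : ∀ x, P (HilbertTensor.coe x)) : P x :=
  HilbertTensor.denseRange_coe.induction_on x hc h

/-- The bounded operator `S ⊗ T` on the Hilbert space tensor product. -/
def opTensor (S : H →L[ℂ] H) (T : K →L[ℂ] K) : HilbertTensor H K →L[ℂ] HilbertTensor H K :=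
  let A : UniformSpace.Completion (H ⊗[ℂ] K) →L[ℂ] UniformSpace.Completion (H ⊗[ℂ] K) :=
    (TensorProduct.mapL S T).completion
  A

lemma opTensor_coe (S : H →L[ℂ] H) (T : K →L[ℂ] K) (x : H ⊗[ℂ] K) :
    opTensor S T (HilbertTensor.coe x) = HilbertTensor.coe (TensorProduct.mapL S T x) :=
  ContinuousLinearMap.completion_apply_coe (TensorProduct.mapL S T) x

lemma opTensor_ext {A B : HilbertTensor H K →L[ℂ] HilbertTensor H K}
    (h : ∀ x : H ⊗[ℂ] K, A (HilbertTensor.coe x) = B (HilbertTensor.coe x)) : A = B := by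
  ext x
  induction x using HilbertTensor.induction_on with
  | hc => exact isClosed_eq (by fun_prop) (by fun_prop)
  | h x => exact h x

lemma opTensor_add_left (S S' : H →L[ℂ] H) (T : K →L[ℂ] K) :
    opTensor (S + S') T = opTensor S T + opTensor S' T :=
  opTensor_ext fun x => by
    simp [opTensor_coe, TensorProduct.mapL_add_left]

lemma opTensor_add_right (S : H →L[ℂ] H) (T T' : K →L[ℂ] K) :
    opTensor S (T + T') = opTensor S T + opTensor S T' :=
  opTensor_ext fun x => by
    simp [opTensor_coe, TensorProduct.mapL_add_right]

lemma opTensor_smul_left (c : ℂ) (S : H →L[ℂ] H) (T : K →L[ℂ] K) :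
    opTensor (c • S) T = c • opTensor S T :=
  opTensor_ext fun x => by
    simp [opTensor_coe, TensorProduct.mapL_smul_left]

lemma opTensor_smul_right (c : ℂ) (S : H →L[ℂ] H) (T : K →L[ℂ] K) :
    opTensor S (c • T) = c • opTensor S T :=
  opTensor_ext fun x => by
    simp [opTensor_coe, TensorProduct.mapL_smul_right]

lemma opTensor_mul (S S' : H →L[ℂ] H) (T T' : K →L[ℂ] K) :
    opTensor S T * opTensor S' T' = opTensor (S * S') (T * T') :=
  opTensor_ext fun x => by
    simp only [mul_apply_eq_comp, opTensor_coe, TensorProduct.mapL_mul]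

lemma opTensor_one : opTensor (1 : H →L[ℂ] H) (1 : K →L[ℂ] K) = 1 :=
  opTensor_ext fun x => by
    rw [opTensor_coe, ContinuousLinearMap.one_def, ContinuousLinearMap.one_def,
      TensorProduct.mapL_id_id]; rfl

lemma star_opTensor [CompleteSpace H] [CompleteSpace K] (S : H →L[ℂ] H) (T : K →L[ℂ] K) :
    star (opTensor S T) = opTensor (star S) (star T) := by
  symm
  rw [ContinuousLinearMap.star_eq_adjoint (opTensor S T), ContinuousLinearMap.eq_adjoint_iff]
  have key : ∀ x y : H ⊗[ℂ] K, inner ℂ (TensorProduct.mapL (star S) (star T) x) y =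
      inner ℂ x (TensorProduct.mapL S T y) := by
    intro x y
    induction x using TensorProduct.induction_on with
    | zero => simp
    | add a b ha hb => simp only [map_add, inner_add_left, ha, hb]
    | tmul a b =>
      induction y using TensorProduct.induction_on with
      | zero => simp
      | add c d hc hd => simp only [map_add, inner_add_right, hc, hd]
      | tmul c d =>
        simp only [TensorProduct.mapL_tmul, TensorProduct.inner_tmul,
          ContinuousLinearMap.star_eq_adjoint, ContinuousLinearMap.adjoint_inner_left]
  intro x y
  induction x using HilbertTensor.induction_on with
  | hc => exact isClosed_eq (by fun_prop) (by fun_prop)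
  | h x =>
    induction y using HilbertTensor.induction_on with
    | hc => exact isClosed_eq (by fun_prop) (by fun_prop)
    | h y => rw [opTensor_coe, opTensor_coe, LinearIsometry.inner_map_map,
        LinearIsometry.inner_map_map, key]

lemma norm_opTensor_le (S : H →L[ℂ] H) (T : K →L[ℂ] K) : ‖opTensor S T‖ ≤ ‖S‖ * ‖T‖ := by
  refine ContinuousLinearMap.opNorm_le_bound _ (by positivity) fun x => ?_
  induction x using HilbertTensor.induction_on with
  | hc => exact isClosed_le (by fun_prop) (by fun_prop)
  | h x =>
    rw [opTensor_coe, LinearIsometry.norm_map, LinearIsometry.norm_map]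
    exact ContinuousLinearMap.le_of_opNorm_le _ (TensorProduct.norm_mapL_le S T) x

end OpTensor

section RepTensor

variable {A B : Type*} [CStarAlgebra A] [CStarAlgebra B]
variable {H K : Type*} [NormedAddCommGroup H] [InnerProductSpace ℂ H] [CompleteSpace H]
  [NormedAddCommGroup K] [InnerProductSpace ℂ K] [CompleteSpace K]

/-- The representation `π ⊗ ρ` of the algebraic tensor product, `a ⊗ b ↦ π a ⊗ ρ b`. -/
def repTensor (π : A →⋆ₐ[ℂ] (H →L[ℂ] H)) (ρ : B →⋆ₐ[ℂ] (K →L[ℂ] K)) :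
    A ⊗[ℂ] B →⋆ₐ[ℂ] (HilbertTensor H K →L[ℂ] HilbertTensor H K) :=
  let f : A ⊗[ℂ] B →ₐ[ℂ] (HilbertTensor H K →L[ℂ] HilbertTensor H K) :=
    Algebra.TensorProduct.algHomOfLinearMapTensorProduct
      (TensorProduct.lift (LinearMap.mk₂ ℂ (fun a b => opTensor (π a) (ρ b))
        (fun a a' b => by rw [map_add, opTensor_add_left])
        (fun c a b => by rw [map_smul, opTensor_smul_left])
        (fun a b b' => by rw [map_add, opTensor_add_right])
        (fun c a b => by rw [map_smul, opTensor_smul_right])))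
      (fun a a' b b' => by simp [opTensor_mul])
      (by simp [opTensor_one])
  { __ := f
    map_star' := fun x => by
      change f (star x) = star (f x)
      induction x using TensorProduct.induction_on with
      | zero => simp
      | add a b ha hb => rw [star_add, map_add, map_add, star_add, ha, hb]
      | tmul a b => simp [f, star_opTensor, map_star] }

lemma repTensor_tmul (π : A →⋆ₐ[ℂ] (H →L[ℂ] H)) (ρ : B →⋆ₐ[ℂ] (K →L[ℂ] K)) (a : A) (b : B) :
    repTensor π ρ (a ⊗ₜ b) = opTensor (π a) (ρ b) := rfl

end RepTensor

section MinTensor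

variable (A B : Type) [CStarAlgebra A] [CStarAlgebra B]

/-- The C⋆-seminorms `x ↦ ‖(π ⊗ ρ) x‖` on the algebraic tensor product `A ⊗ B`, where `π` and `ρ`
are representations of `A` and of `B` on Hilbert spaces. -/
def spatialSeminorms : Set (CStarSeminorm (A ⊗[ℂ] B)) :=
  {p | ∃ (H K : Type) (_ : NormedAddCommGroup H) (_ : InnerProductSpace ℂ H) (_ : CompleteSpace H)
    (_ : NormedAddCommGroup K) (_ : InnerProductSpace ℂ K) (_ : CompleteSpace K)
    (π : A →⋆ₐ[ℂ] (H →L[ℂ] H)) (ρ : B →⋆ₐ[ℂ] (K →L[ℂ] K)),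
    p = CStarSeminorm.ofHom (repTensor π ρ)}

lemma spatialSeminorms_bddAbove (x : A ⊗[ℂ] B) :
    BddAbove ((fun p : CStarSeminorm (A ⊗[ℂ] B) => p x) '' spatialSeminorms A B) := by
  suffices h : ∃ M : ℝ, ∀ p ∈ spatialSeminorms A B, p x ≤ M by
    obtain ⟨M, hM⟩ := h
    exact ⟨M, by rintro _ ⟨p, hp, rfl⟩; exact hM p hp⟩
  induction x using TensorProduct.induction_on with
  | zero => exact ⟨0, fun p _ => p.zero_eq.le⟩
  | add x y hx hy =>
    obtain ⟨M, hM⟩ := hx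
    obtain ⟨N, hN⟩ := hy
    exact ⟨M + N, fun p hp => (p.add_le x y).trans (add_le_add (hM p hp) (hN p hp))⟩
  | tmul a b =>
    refine ⟨‖a‖ * ‖b‖, ?_⟩
    rintro _ ⟨H, K, _, _, _, _, _, _, π, ρ, rfl⟩
    change ‖repTensor π ρ (a ⊗ₜ b)‖ ≤ _
    rw [repTensor_tmul]
    refine (norm_opTensor_le _ _).trans ?_
    gcongr
    · exact NonUnitalStarAlgHom.norm_apply_le π a
    · exact NonUnitalStarAlgHom.norm_apply_le ρ b

/-- The minimal C⋆-norm on the algebraic tensor product. -/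
def minSeminorm : CStarSeminorm (A ⊗[ℂ] B) :=
  CStarSeminorm.sup (spatialSeminorms A B) (spatialSeminorms_bddAbove A B)

instance : StarModule ℂ (A ⊗[ℂ] B) where
  star_smul c x := by
    induction x using TensorProduct.induction_on with
    | zero => simp
    | add a b ha hb => rw [smul_add, star_add, star_add, smul_add, ha, hb]
    | tmul a b => simp [TensorProduct.smul_tmul']

/-- The minimal tensor product of two unital C⋆-algebras. -/
def MinTensor : Type := (minSeminorm A B).Compl

instance : CStarAlgebra (MinTensor A B) := inferInstanceAs (CStarAlgebra (minSeminorm A B).Compl)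

variable {A B}

namespace MinTensor

/-- The canonical ⋆-homomorphism of the algebraic into the minimal tensor product. -/
def of : A ⊗[ℂ] B →⋆ₐ[ℂ] MinTensor A B := CStarSeminorm.Compl.coe (minSeminorm A B)

/-- The elementary tensor `a ⊗ b` in the minimal tensor product. -/
def tmul (a : A) (b : B) : MinTensor A B := of (a ⊗ₜ[ℂ] b)

lemma denseRange_of : DenseRange (of : A ⊗[ℂ] B → MinTensor A B) :=
  CStarSeminorm.Compl.denseRange_coe _

variable {C D : Type} [CStarAlgebra C] [CStarAlgebra D]

/-- The tensor product of ⋆-homomorphisms on the algebraic tensor product. -/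
def algMap (φ : A →⋆ₐ[ℂ] C) (ψ : B →⋆ₐ[ℂ] D) : A ⊗[ℂ] B →⋆ₐ[ℂ] C ⊗[ℂ] D where
  __ := Algebra.TensorProduct.map (φ : A →ₐ[ℂ] C) (ψ : B →ₐ[ℂ] D)
  map_star' x := by
    change Algebra.TensorProduct.map (φ : A →ₐ[ℂ] C) (ψ : B →ₐ[ℂ] D) (star x) =
      star (Algebra.TensorProduct.map (φ : A →ₐ[ℂ] C) (ψ : B →ₐ[ℂ] D) x)
    induction x using TensorProduct.induction_on with
    | zero => simp
    | add a b ha hb => rw [star_add, map_add, map_add, star_add, ha, hb]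
    | tmul a b => simp [map_star]

lemma norm_of_algMap_le (φ : A →⋆ₐ[ℂ] C) (ψ : B →⋆ₐ[ℂ] D) (x : A ⊗[ℂ] B) :
    ‖of (algMap φ ψ x)‖ ≤ minSeminorm A B x := by
  refine (CStarSeminorm.Compl.norm_coe (minSeminorm C D) _).trans_le ?_
  refine CStarSeminorm.sup_le _ ((minSeminorm A B).nonneg x) ?_
  rintro _ ⟨H, K, _, _, _, _, _, _, π, ρ, rfl⟩
  have h : repTensor π ρ (algMap φ ψ x) = repTensor (π.comp φ) (ρ.comp ψ) x := by
    induction x using TensorProduct.induction_on with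
    | zero => simp
    | add a b ha hb => rw [map_add, map_add, map_add, ha, hb]
    | tmul a b => rfl
  change ‖repTensor π ρ (algMap φ ψ x)‖ ≤ _
  rw [h]
  exact CStarSeminorm.le_sup (spatialSeminorms_bddAbove A B)
    (p := CStarSeminorm.ofHom (repTensor (π.comp φ) (ρ.comp ψ)))
    ⟨H, K, _, _, _, _, _, _, π.comp φ, ρ.comp ψ, rfl⟩ x

/-- The tensor product `φ ⊗ ψ` of ⋆-homomorphisms on the minimal tensor product. -/
def map (φ : A →⋆ₐ[ℂ] C) (ψ : B →⋆ₐ[ℂ] D) : MinTensor A B →⋆ₐ[ℂ] MinTensor C D :=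
  CStarSeminorm.Compl.lift (minSeminorm A B) (of.comp (algMap φ ψ)) (norm_of_algMap_le φ ψ)

lemma map_tmul (φ : A →⋆ₐ[ℂ] C) (ψ : B →⋆ₐ[ℂ] D) (a : A) (b : B) :
    map φ ψ (tmul a b) = tmul (φ a) (ψ b) :=
  CStarSeminorm.Compl.lift_coe (minSeminorm A B) (of.comp (algMap φ ψ)) (norm_of_algMap_le φ ψ) _

end MinTensor

end MinTensor

/-- A unital ⋆-homomorphism `Δ : A → A ⊗ A` is the comultiplication of a compact quantum group: it
is coassociative, as a map into `A ⊗ A ⊗ A` (the two ways of bracketing are identified by the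
canonical isomorphism), and has the cancellation property. -/
structure IsCompactQuantumGroup {A : Type} [CStarAlgebra A] (Δ : A →⋆ₐ[ℂ] MinTensor A A) :
    Prop where
  coassoc : ∃ Φ : MinTensor (MinTensor A A) A ≃⋆ₐ[ℂ] MinTensor A (MinTensor A A),
    (∀ a b c : A, Φ (MinTensor.tmul (MinTensor.tmul a b) c) =
      MinTensor.tmul a (MinTensor.tmul b c)) ∧
    ∀ a : A, Φ (MinTensor.map Δ (StarAlgHom.id ℂ A) (Δ a)) =
      MinTensor.map (StarAlgHom.id ℂ A) Δ (Δ a)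
  dense_left : Dense (Submodule.span ℂ
    {x : MinTensor A A | ∃ a b : A, x = MinTensor.tmul a 1 * Δ b} : Set (MinTensor A A))
  dense_right : Dense (Submodule.span ℂ
    {x : MinTensor A A | ∃ a b : A, x = MinTensor.tmul 1 a * Δ b} : Set (MinTensor A A))

/-- The free unital complex ⋆-algebra on a set `X` of generators: noncommutative polynomials in the
letters `x = (x, false)` and `x⋆ = (x, true)`. -/
def FreeStarAlgebra (X : Type*) : Type _ := FreeAlgebra ℂ (X × Bool)

namespace FreeStarAlgebra

variable {X : Type*}

instance : Ring (FreeStarAlgebra X) := inferInstanceAs (Ring (FreeAlgebra ℂ (X × Bool)))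
instance : Algebra ℂ (FreeStarAlgebra X) :=
  inferInstanceAs (Algebra ℂ (FreeAlgebra ℂ (X × Bool)))

/-- The letters. -/
def letter (y : X × Bool) : FreeStarAlgebra X := FreeAlgebra.ι ℂ y

/-- The generators. -/
def gen (x : X) : FreeStarAlgebra X := letter (x, false)

/-- The opposite algebra, with complex scalars acting through complex conjugation. -/
def ConjOp (X : Type*) : Type _ := (FreeStarAlgebra X)ᵐᵒᵖ

instance : Ring (ConjOp X) := inferInstanceAs (Ring (FreeStarAlgebra X)ᵐᵒᵖ)

instance : Algebra ℂ (ConjOp X) :=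
  let f : ℂ →+* (FreeStarAlgebra X)ᵐᵒᵖ :=
    (algebraMap ℂ (FreeStarAlgebra X)ᵐᵒᵖ).comp (starRingEnd ℂ)
  have hf : ∀ (c : ℂ) (x : (FreeStarAlgebra X)ᵐᵒᵖ), f c * x = x * f c :=
    fun c x => Algebra.commutes (star c) x
  RingHom.toAlgebra' (S := ConjOp X) f hf

/-- The involution, as a conjugate linear antihomomorphism. -/
def starHom : FreeStarAlgebra X →ₐ[ℂ] ConjOp X :=
  FreeAlgebra.lift ℂ (fun y : X × Bool => (MulOpposite.op (letter (y.1, !y.2)) : ConjOp X))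

instance : Star (FreeStarAlgebra X) := ⟨fun a => MulOpposite.unop (starHom a)⟩

lemma star_letter (y : X × Bool) : star (letter y) = letter (y.1, !y.2) :=
  congrArg MulOpposite.unop (FreeAlgebra.lift_ι_apply (R := ℂ) (A := ConjOp X) _ y)

lemma star_algebraMap' (c : ℂ) :
    star (algebraMap ℂ (FreeStarAlgebra X) c) = algebraMap ℂ (FreeStarAlgebra X) (star c) :=
  congrArg MulOpposite.unop ((starHom (X := X)).commutes c)

lemma star_mul' (a b : FreeStarAlgebra X) : star (a * b) = star b * star a :=
  congrArg MulOpposite.unop (map_mul starHom a b)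

lemma star_add' (a b : FreeStarAlgebra X) : star (a + b) = star a + star b :=
  congrArg MulOpposite.unop (map_add starHom a b)

lemma induction {P : FreeStarAlgebra X → Prop} (h0 : ∀ c, P (algebraMap ℂ _ c))
    (h1 : ∀ y, P (letter y)) (hm : ∀ a b, P a → P b → P (a * b))
    (ha : ∀ a b, P a → P b → P (a + b)) (a : FreeStarAlgebra X) : P a :=
  FreeAlgebra.induction ℂ (X × Bool) (motive := P) h0 h1 hm ha a

instance : StarRing (FreeStarAlgebra X) where
  star_involutive a := by
    induction a using induction with
    | h0 c => simp [star_algebraMap']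
    | h1 y => simp [star_letter]
    | hm a b ha hb => rw [star_mul', star_mul', ha, hb]
    | ha a b ha hb => rw [star_add', star_add', ha, hb]
  star_mul := star_mul'
  star_add := star_add'

instance : StarModule ℂ (FreeStarAlgebra X) where
  star_smul c a := by
    rw [Algebra.smul_def, star_mul, star_algebraMap', Algebra.smul_def, Algebra.commutes]

variable {B : Type*} [Ring B] [Algebra ℂ B] [StarRing B] [StarModule ℂ B]

/-- The evaluation of noncommutative ⋆-polynomials at given elements of a ⋆-algebra. -/
def eval (b : X → B) : FreeStarAlgebra X →⋆ₐ[ℂ] B :=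
  let f : FreeStarAlgebra X →ₐ[ℂ] B :=
    FreeAlgebra.lift ℂ (fun y : X × Bool => if y.2 then star (b y.1) else b y.1)
  have hf : ∀ y, f (letter y) = if y.2 then star (b y.1) else b y.1 :=
    fun y => FreeAlgebra.lift_ι_apply (R := ℂ) _ y
  { __ := f
    map_star' := fun a => by
      change f (star a) = star (f a)
      induction a using induction with
      | h0 c => rw [star_algebraMap', AlgHom.commutes, AlgHom.commutes, algebraMap_star_comm]
      | h1 y =>
        rw [star_letter, hf, hf]
        rcases y with ⟨x, _ | _⟩ <;> simp
      | hm a b ha hb => rw [star_mul, map_mul, map_mul, star_mul, ha, hb]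
      | ha a b ha hb => rw [star_add, map_add, map_add, star_add, ha, hb] }

lemma eval_gen (b : X → B) (x : X) : eval b (gen x) = b x :=
  FreeAlgebra.lift_ι_apply (R := ℂ) (A := B) _ (x, false)

end FreeStarAlgebra

/-- The defining relations of the quantum group `SU_q(2)`. -/
structure SUqRelations {B : Type*} [Ring B] [Algebra ℂ B] [StarRing B] (q : ℝ) (a b : B) :
    Prop where
  star_a_mul_a : star a * a + star b * b = 1
  a_mul_star_a : a * star a + ((q : ℂ) ^ 2) • (b * star b) = 1
  a_mul_b : a * b = (q : ℂ) • (b * a)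
  a_mul_star_b : a * star b = (q : ℂ) • (star b * a)
  normal : star b * b = b * star b

lemma SUqRelations.map {B C : Type*} [Ring B] [Algebra ℂ B] [StarRing B] [Ring C] [Algebra ℂ C]
    [StarRing C] {q : ℝ} {a b : B} (h : SUqRelations q a b) (φ : B →⋆ₐ[ℂ] C) :
    SUqRelations q (φ a) (φ b) where
  star_a_mul_a := by
    rw [← map_star, ← map_star, ← map_mul, ← map_mul, ← map_add, h.star_a_mul_a, map_one]
  a_mul_star_a := by
    rw [← map_star, ← map_star, ← map_mul, ← map_mul, ← map_smul, ← map_add, h.a_mul_star_a,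
      map_one]
  a_mul_b := by rw [← map_mul, h.a_mul_b, map_smul, map_mul]
  a_mul_star_b := by rw [← map_star, ← map_mul, h.a_mul_star_b, map_smul, map_mul]
  normal := by rw [← map_star, ← map_mul, h.normal, map_mul]

open scoped ComplexOrder in
lemma norm_le_one_of_add_eq_one {B : Type*} [CStarAlgebra B] {a b : B}
    (h : star a * a + star b * b = 1) : ‖a‖ ≤ 1 := by
  let _ : PartialOrder B := CStarAlgebra.spectralOrder B
  have _ : StarOrderedRing B := CStarAlgebra.spectralOrderedRing B
  have h1 : star a * a ≤ 1 := by
    rw [← h]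
    exact le_add_of_nonneg_right (star_mul_self_nonneg b)
  have h2 := (CStarAlgebra.norm_le_one_iff_of_nonneg (star a * a) (star_mul_self_nonneg a)).2 h1
  rw [CStarRing.norm_star_mul_self] at h2
  nlinarith [norm_nonneg a]

namespace SUq

/-- The free ⋆-algebra on the two letters `α = gen false` and `β = gen true`. -/
abbrev Free : Type := FreeStarAlgebra Bool

open FreeStarAlgebra in
lemma relations_iff {C : Type*} [Ring C] [Algebra ℂ C] [StarRing C] {q : ℝ} (φ : Free →⋆ₐ[ℂ] C) :
    SUqRelations q (φ (gen false)) (φ (gen true)) ↔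
      φ (star (gen false) * gen false + star (gen true) * gen true) = φ 1 ∧
      φ (gen false * star (gen false) + ((q : ℂ) ^ 2) • (gen true * star (gen true))) = φ 1 ∧
      φ (gen false * gen true) = φ ((q : ℂ) • (gen true * gen false)) ∧
      φ (gen false * star (gen true)) = φ ((q : ℂ) • (star (gen true) * gen false)) ∧
      φ (star (gen true) * gen true) = φ (gen true * star (gen true)) := by
  simp only [map_add, map_mul, map_smul, map_star, map_one]
  exact ⟨fun h => ⟨h.1, h.2, h.3, h.4, h.5⟩, fun h => ⟨h.1, h.2.1, h.2.2.1, h.2.2.2.1, h.2.2.2.2⟩⟩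

/-- The C⋆-seminorms on the free ⋆-algebra on two letters `α`, `β` for which the images of `α` and
`β` in the completion satisfy the relations of `SU_q(2)`. -/
def seminorms (q : ℝ) : Set (CStarSeminorm Free) :=
  {p | SUqRelations q (CStarSeminorm.Compl.coe p (FreeStarAlgebra.gen false))
    (CStarSeminorm.Compl.coe p (FreeStarAlgebra.gen true))}

lemma seminorms_bddAbove (q : ℝ) (x : Free) :
    BddAbove ((fun p : CStarSeminorm Free => p x) '' seminorms q) := by
  suffices h : ∃ M : ℝ, ∀ p ∈ seminorms q, p x ≤ M by
    obtain ⟨M, hM⟩ := h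
    exact ⟨M, by rintro _ ⟨p, hp, rfl⟩; exact hM p hp⟩
  have hα : ∀ p ∈ seminorms q, p (FreeStarAlgebra.gen false) ≤ 1 := fun p hp => by
    rw [← CStarSeminorm.Compl.norm_coe]
    exact norm_le_one_of_add_eq_one hp.star_a_mul_a
  have hβ : ∀ p ∈ seminorms q, p (FreeStarAlgebra.gen true) ≤ 1 := fun p hp => by
    rw [← CStarSeminorm.Compl.norm_coe]
    exact norm_le_one_of_add_eq_one ((add_comm _ _).trans hp.star_a_mul_a)
  induction x using FreeStarAlgebra.induction with
  | h0 c =>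
    refine ⟨‖c‖ * 1, fun p hp => ?_⟩
    rw [Algebra.algebraMap_eq_smul_one, p.smul_eq]
    gcongr
    have h1 := p.star_mul_self 1
    rw [star_one, one_mul] at h1
    have h2 := p.nonneg 1
    by_contra! h3
    nlinarith
  | h1 y =>
    refine ⟨1, fun p hp => ?_⟩
    have h : p (FreeStarAlgebra.gen y.1) ≤ 1 := by
      rcases y with ⟨_ | _, _⟩
      · exact hα p hp
      · exact hβ p hp
    rcases y with ⟨x, _ | _⟩
    · exact h
    · rw [← p.star_eq, FreeStarAlgebra.star_letter]
      exact h
  | hm a b ha hb =>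
    obtain ⟨M, hM⟩ := ha
    obtain ⟨N, hN⟩ := hb
    exact ⟨M * N, fun p hp => (p.mul_le a b).trans (mul_le_mul (hM p hp) (hN p hp) (p.nonneg b)
      ((p.nonneg a).trans (hM p hp)))⟩
  | ha a b ha hb =>
    obtain ⟨M, hM⟩ := ha
    obtain ⟨N, hN⟩ := hb
    exact ⟨M + N, fun p hp => (p.add_le a b).trans (add_le_add (hM p hp) (hN p hp))⟩

/-- The largest C⋆-seminorm on noncommutative ⋆-polynomials in `α`, `β` that respects the relations
of `SU_q(2)`. -/
def seminorm (q : ℝ) : CStarSeminorm Free :=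
  CStarSeminorm.sup (seminorms q) (seminorms_bddAbove q)

end SUq

/-- The universal C⋆-algebra `C(SU_q(2))` generated by two elements `α`, `β` that satisfy the
relations of `SU_q(2)`. -/
def SUq (q : ℝ) : Type := (SUq.seminorm q).Compl

namespace SUq

instance (q : ℝ) : CStarAlgebra (SUq q) := inferInstanceAs (CStarAlgebra (seminorm q).Compl)

/-- The canonical ⋆-homomorphism of the free ⋆-algebra. -/
def of (q : ℝ) : Free →⋆ₐ[ℂ] SUq q := CStarSeminorm.Compl.coe (seminorm q)

lemma denseRange_of (q : ℝ) : DenseRange (of q) := CStarSeminorm.Compl.denseRange_coe _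

/-- The generator `α`. -/
def α (q : ℝ) : SUq q := of q (FreeStarAlgebra.gen false)

/-- The generator `β`. -/
def β (q : ℝ) : SUq q := of q (FreeStarAlgebra.gen true)

/-- A relation holds in the completion if and only if the seminorm vanishes on the relator. -/
lemma coe_eq_coe_iff (p : CStarSeminorm Free) (x y : Free) :
    CStarSeminorm.Compl.coe p x = CStarSeminorm.Compl.coe p y ↔ p (x - y) = 0 := by
  rw [← sub_eq_zero, ← map_sub, ← norm_eq_zero, CStarSeminorm.Compl.norm_coe]

lemma of_eq {q : ℝ} (x y : Free)
    (h : ∀ p ∈ seminorms q, CStarSeminorm.Compl.coe p x = CStarSeminorm.Compl.coe p y) :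
    of q x = of q y := by
  refine (coe_eq_coe_iff (seminorm q) x y).2 ?_
  exact le_antisymm (CStarSeminorm.sup_le _ le_rfl
    fun p hp => ((coe_eq_coe_iff p x y).1 (h p hp)).le) ((seminorm q).nonneg _)

lemma relations (q : ℝ) : SUqRelations q (α q) (β q) :=
  (relations_iff (of q)).2 ⟨of_eq _ _ fun _ hp => ((relations_iff _).1 hp).1,
    of_eq _ _ fun _ hp => ((relations_iff _).1 hp).2.1,
    of_eq _ _ fun _ hp => ((relations_iff _).1 hp).2.2.1,
    of_eq _ _ fun _ hp => ((relations_iff _).1 hp).2.2.2.1,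
    of_eq _ _ fun _ hp => ((relations_iff _).1 hp).2.2.2.2⟩

variable {B : Type*} [CStarAlgebra B]

lemma ofHom_eq {φ : Free →⋆ₐ[ℂ] B} (x y : Free) (h : φ x = φ y) :
    CStarSeminorm.Compl.coe (CStarSeminorm.ofHom φ) x =
      CStarSeminorm.Compl.coe (CStarSeminorm.ofHom φ) y := by
  rw [coe_eq_coe_iff]
  change ‖φ (x - y)‖ = 0
  rw [map_sub, h, sub_self, norm_zero]

lemma ofHom_eval_mem {q : ℝ} {a b : B} (h : SUqRelations q a b) :
    CStarSeminorm.ofHom (FreeStarAlgebra.eval fun i => cond i b a) ∈ seminorms q := by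
  have h' : SUqRelations q
      (FreeStarAlgebra.eval (fun i => cond i b a) (FreeStarAlgebra.gen false))
      (FreeStarAlgebra.eval (fun i => cond i b a) (FreeStarAlgebra.gen true)) := by
    rwa [FreeStarAlgebra.eval_gen, FreeStarAlgebra.eval_gen]
  obtain ⟨h1, h2, h3, h4, h5⟩ := (relations_iff _).1 h'
  exact (relations_iff _).2
    ⟨ofHom_eq _ _ h1, ofHom_eq _ _ h2, ofHom_eq _ _ h3, ofHom_eq _ _ h4, ofHom_eq _ _ h5⟩

lemma norm_eval_le {q : ℝ} {a b : B} (h : SUqRelations q a b) (x : Free) :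
    ‖FreeStarAlgebra.eval (fun i => cond i b a) x‖ ≤ seminorm q x :=
  CStarSeminorm.le_sup (seminorms_bddAbove q) (ofHom_eval_mem h) x

/-- The universal property: elements `a`, `b` of a C⋆-algebra that satisfy the relations define a
⋆-homomorphism with `α ↦ a` and `β ↦ b`. -/
def lift {q : ℝ} {a b : B} (h : SUqRelations q a b) : SUq q →⋆ₐ[ℂ] B :=
  CStarSeminorm.Compl.lift (seminorm q) (FreeStarAlgebra.eval fun i => cond i b a)
    (norm_eval_le h)

lemma lift_α {q : ℝ} {a b : B} (h : SUqRelations q a b) : lift h (α q) = a :=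
  (CStarSeminorm.Compl.lift_coe (seminorm q) _ (norm_eval_le h) _).trans
    (FreeStarAlgebra.eval_gen _ false)

lemma lift_β {q : ℝ} {a b : B} (h : SUqRelations q a b) : lift h (β q) = b :=
  (CStarSeminorm.Compl.lift_coe (seminorm q) _ (norm_eval_le h) _).trans
    (FreeStarAlgebra.eval_gen _ true)

end SUq

open TensorProduct in
/-- If `α`, `β` satisfy the relations of `SU_q(2)`, then so do `α ⊗ α - q β⋆ ⊗ β` and
`β ⊗ α + α⋆ ⊗ β`. -/
lemma SUqRelations.comul {A : Type*} [Ring A] [Algebra ℂ A] [StarRing A] [StarModule ℂ A] {q : ℝ}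
    {a b : A} (h : SUqRelations q a b) :
    SUqRelations q (a ⊗ₜ[ℂ] a - (q : ℂ) • (star b ⊗ₜ[ℂ] b)) (b ⊗ₜ[ℂ] a + star a ⊗ₜ[ℂ] b) := by
  have r1 : star a * a = 1 - star b * b := eq_sub_of_add_eq h.1
  have r2 : a * star a = 1 - ((q : ℂ) ^ 2) • (star b * b) := by
    rw [h.normal]; exact eq_sub_of_add_eq h.2
  have r3 := h.3
  have r4 := h.4
  have r5 := h.5.symm
  have r6 : star b * star a = (q : ℂ) • (star a * star b) := by
    simpa using congrArg star r3
  have r7 : b * star a = (q : ℂ) • (star a * b) := by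
    simpa using congrArg star r4
  have s1 : star (a ⊗ₜ[ℂ] a - (q : ℂ) • (star b ⊗ₜ[ℂ] b)) =
      star a ⊗ₜ[ℂ] star a - (q : ℂ) • (b ⊗ₜ[ℂ] star b) := by
    rw [star_sub, star_smul]
    simp
  have s2 : star (b ⊗ₜ[ℂ] a + star a ⊗ₜ[ℂ] b) = star b ⊗ₜ[ℂ] star a + a ⊗ₜ[ℂ] star b := by
    rw [star_add]
    simp
  refine ⟨?_, ?_, ?_, ?_, ?_⟩ <;>
  · try simp only [s1, s2]
    simp only [add_mul, mul_add, sub_mul, mul_sub, smul_mul_assoc, mul_smul_comm,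
      Algebra.TensorProduct.tmul_mul_tmul, r1, r2, r3, r4, r5, r6, r7, tmul_sub, sub_tmul, tmul_smul,
      smul_tmul', Algebra.TensorProduct.one_def]
    simp only [← smul_tmul']
    module

namespace SUq

lemma comul_relations (q : ℝ) : SUqRelations q
    (MinTensor.tmul (α q) (α q) - (q : ℂ) • MinTensor.tmul (star (β q)) (β q))
    (MinTensor.tmul (β q) (α q) + MinTensor.tmul (star (α q)) (β q)) := by
  have h := (relations q).comul.map MinTensor.of
  rwa [map_sub, map_smul, map_add] at h

/-- The comultiplication of `SU_q(2)`: `Δ(α) = α ⊗ α - q β⋆ ⊗ β` and `Δ(β) = β ⊗ α + α⋆ ⊗ β`. -/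
def comul (q : ℝ) : SUq q →⋆ₐ[ℂ] MinTensor (SUq q) (SUq q) := lift (comul_relations q)

lemma comul_α (q : ℝ) : comul q (α q) =
    MinTensor.tmul (α q) (α q) - (q : ℂ) • MinTensor.tmul (star (β q)) (β q) :=
  lift_α (comul_relations q)

lemma comul_β (q : ℝ) : comul q (β q) =
    MinTensor.tmul (β q) (α q) + MinTensor.tmul (star (α q)) (β q) :=
  lift_β (comul_relations q)

end SUq

/-! ### Operators -/

/-- The Hilbert space `ℓ²(ℕ)`. -/
abbrev EllTwo : Type := lp (fun _ : ℕ => ℂ) 2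

namespace EllTwo

/-- The diagonal operator `e_k ↦ c k • e_k` on `ℓ²(ℕ)`, for a sequence bounded by `1`. -/
def diag (c : ℕ → ℂ) (hc : ∀ k, ‖c k‖ ≤ 1) : EllTwo →L[ℂ] EllTwo :=
  have hle : ∀ (f : EllTwo) (k : ℕ), ‖c k * f k‖ ≤ ‖f k‖ := fun f k => by
    rw [norm_mul]
    exact mul_le_of_le_one_left (norm_nonneg _) (hc k)
  LinearMap.mkContinuous
    { toFun := fun f => ⟨fun k => c k * f k, (lp.memℓp f).mono' (hle f)⟩
      map_add' := fun f g => by ext k; exact mul_add (c k) (f k) (g k)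
      map_smul' := fun z f => by ext k; exact mul_left_comm (c k) z (f k) } 1 (fun f => by
        rw [one_mul]
        exact lp.norm_mono two_ne_zero (hle f))

lemma diag_apply {c : ℕ → ℂ} (hc : ∀ k, ‖c k‖ ≤ 1) (f : EllTwo) (k : ℕ) :
    diag c hc f k = c k * f k := rfl

lemma summable_sq (f : EllTwo) : Summable fun k => ‖f k‖ ^ (2 : ENNReal).toReal :=
  (lp.memℓp f).summable (by norm_num)

/-- The operator `S` on `ℓ²(ℕ)` with `S e_k = e_(k-1)` for `k > 0` and `S e_0 = 0`. -/
def shift : EllTwo →L[ℂ] EllTwo :=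
  have hs : ∀ f : EllTwo, Summable fun k => ‖f (k + 1)‖ ^ (2 : ENNReal).toReal := fun f =>
    (summable_nat_add_iff 1).2 (summable_sq f)
  LinearMap.mkContinuous
    { toFun := fun f => ⟨fun k => f (k + 1), memℓp_gen (hs f)⟩
      map_add' := fun f g => rfl
      map_smul' := fun z f => rfl } 1 (fun f => by
        rw [one_mul]
        refine lp.norm_le_of_tsum_le (by norm_num) (norm_nonneg f) ?_
        rw [lp.norm_rpow_eq_tsum (by norm_num) f, (summable_sq f).tsum_eq_zero_add]
        exact le_add_of_nonneg_left (by positivity))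

lemma shift_apply (f : EllTwo) (k : ℕ) : shift f k = f (k + 1) := rfl

end EllTwo

/-- The Hilbert space `L²(ℝ)`. -/
abbrev LTwo : Type := MeasureTheory.Lp ℂ 2 (MeasureTheory.volume : MeasureTheory.Measure ℝ)

namespace EllTwo

/-- The sequence `0, f 0, f 1, …`. -/
def prepend (f : ℕ → ℂ) : ℕ → ℂ
  | 0 => 0
  | k + 1 => f k

lemma summable_prepend (f : EllTwo) :
    Summable fun k => ‖prepend f k‖ ^ (2 : ENNReal).toReal :=
  (summable_nat_add_iff (f := fun k => ‖prepend f k‖ ^ (2 : ENNReal).toReal) 1).1 (summable_sq f)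

/-- The operator `e_k ↦ e_(k+1)` on `ℓ²(ℕ)`. -/
def unshift : EllTwo →L[ℂ] EllTwo :=
  LinearMap.mkContinuous
    { toFun := fun f => ⟨prepend f, memℓp_gen (summable_prepend f)⟩
      map_add' := fun f g => by
        ext k
        cases k with
        | zero => exact (add_zero (0 : ℂ)).symm
        | succ k => rfl
      map_smul' := fun z f => by
        ext k
        cases k with
        | zero => exact (mul_zero z).symm
        | succ k => rfl } 1 (fun f => by
        rw [one_mul]
        refine lp.norm_le_of_tsum_le (by norm_num) (norm_nonneg f) ?_
        rw [lp.norm_rpow_eq_tsum (by norm_num) f]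
        have h := (summable_prepend f).tsum_eq_zero_add
        simp only [prepend, norm_zero, ENNReal.toReal_ofNat, Real.rpow_ofNat, ne_eq,
          OfNat.ofNat_ne_zero, not_false_eq_true, zero_pow, zero_add] at h ⊢
        exact h.le)

lemma unshift_zero (f : EllTwo) : unshift f 0 = 0 := rfl

lemma unshift_succ (f : EllTwo) (k : ℕ) : unshift f (k + 1) = f k := rfl

lemma star_shift : star shift = unshift := by
  symm
  rw [ContinuousLinearMap.star_eq_adjoint, ContinuousLinearMap.eq_adjoint_iff]
  intro f g
  have h1 := lp.inner_eq_tsum (𝕜 := ℂ) (unshift f) g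
  have h2 := lp.inner_eq_tsum (𝕜 := ℂ) f (shift g)
  have h3 := (lp.summable_inner (𝕜 := ℂ) (unshift f) g).tsum_eq_zero_add
  rw [unshift_zero, inner_zero_left, zero_add] at h3
  exact h1.trans (h3.trans ((tsum_congr fun k => rfl).trans h2.symm))

lemma star_diag {c : ℕ → ℂ} (hc : ∀ k, ‖c k‖ ≤ 1) (hr : ∀ k, star (c k) = c k) :
    star (diag c hc) = diag c hc := by
  symm
  rw [ContinuousLinearMap.star_eq_adjoint, ContinuousLinearMap.eq_adjoint_iff]
  intro f g
  rw [lp.inner_eq_tsum, lp.inner_eq_tsum]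
  refine tsum_congr fun k => ?_
  have := hr k
  simp only [diag_apply, RCLike.inner_apply, map_mul, starRingEnd_apply, this]
  ring

end EllTwo

namespace LTwo

lemma memLp_char (t : ℝ) : MeasureTheory.MemLp
    (fun x : ℝ => Complex.exp (2 * Real.pi * Complex.I * (t * x : ℝ))) ⊤
    MeasureTheory.volume := by
  refine MeasureTheory.memLp_top_of_bound (by fun_prop) 1 (Filter.Eventually.of_forall fun x => ?_)
  rw [show 2 * (Real.pi : ℂ) * Complex.I * (t * x : ℝ) = (2 * Real.pi * (t * x) : ℝ) * Complex.I by
    push_cast; ring, Complex.norm_exp_ofReal_mul_I]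

/-- The character `x ↦ e^{2πitx}` as an element of `L^∞(ℝ)`. -/
def char (t : ℝ) : MeasureTheory.Lp ℂ ⊤ (MeasureTheory.volume : MeasureTheory.Measure ℝ) :=
  (memLp_char t).toLp

/-- The operator `ξ ↦ e^{2πitx} ξ` of multiplication by a character on `L²(ℝ)`. -/
def mulChar (t : ℝ) : LTwo →L[ℂ] LTwo :=
  LinearMap.mkContinuous
    { toFun := fun ξ => (char t • ξ : LTwo)
      map_add' := fun ξ η => MeasureTheory.Lp.add_smul (q := 2) (r := 2) (char t) ξ η
      map_smul' := fun c ξ => (MeasureTheory.Lp.smul_comm (q := 2) (r := 2) c (char t) ξ).symm } ‖char t‖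
    (fun ξ => MeasureTheory.Lp.norm_smul_le (char t) ξ)

lemma mulChar_apply (t : ℝ) (ξ : LTwo) : mulChar t ξ =ᵐ[MeasureTheory.volume]
    fun x => Complex.exp (2 * Real.pi * Complex.I * (t * x : ℝ)) * ξ x := by
  have h1 : (mulChar t ξ : LTwo) =ᵐ[MeasureTheory.volume] ⇑(char t) • ⇑ξ :=
    MeasureTheory.Lp.coeFn_lpSMul (r := 2) (char t) ξ
  filter_upwards [h1, (memLp_char t).coeFn_toLp] with x hx hx'
  rw [hx, Pi.smul_apply', smul_eq_mul]
  exact congrArg (· * ξ x) hx'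

lemma mulChar_mul (s t : ℝ) : mulChar s * mulChar t = mulChar (s + t) := by
  ext1 ξ
  refine MeasureTheory.Lp.ext ?_
  filter_upwards [mulChar_apply s (mulChar t ξ), mulChar_apply t ξ, mulChar_apply (s + t) ξ]
    with x h1 h2 h3
  rw [mul_apply_eq_comp, h1, h2, h3, ← mul_assoc, ← Complex.exp_add]
  push_cast
  ring_nf

lemma mulChar_zero : mulChar 0 = 1 := by
  ext1 ξ
  refine MeasureTheory.Lp.ext ?_
  filter_upwards [mulChar_apply 0 ξ] with x h1
  rw [h1]
  simp

lemma star_mulChar (t : ℝ) : star (mulChar t) = mulChar (-t) := by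
  symm
  rw [ContinuousLinearMap.star_eq_adjoint, ContinuousLinearMap.eq_adjoint_iff]
  intro ξ η
  rw [MeasureTheory.L2.inner_def, MeasureTheory.L2.inner_def]
  refine MeasureTheory.integral_congr_ae ?_
  filter_upwards [mulChar_apply (-t) ξ, mulChar_apply t η] with x h1 h2
  simp only [h1, h2, RCLike.inner_apply, map_mul, ← Complex.exp_conj, Complex.conj_ofReal,
    Complex.conj_I, map_ofNat]
  push_cast
  ring_nf

/-- The translation operator `(T_s ξ)(x) = ξ(x + s)` on `L²(ℝ)`. -/
def translate (s : ℝ) : LTwo →L[ℂ] LTwo :=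
  (MeasureTheory.Lp.compMeasurePreservingₗᵢ ℂ (fun x : ℝ => x + s)
    (MeasureTheory.measurePreserving_add_right MeasureTheory.volume s)).toContinuousLinearMap

lemma translate_apply (s : ℝ) (ξ : LTwo) :
    translate s ξ =ᵐ[MeasureTheory.volume] fun x => ξ (x + s) :=
  MeasureTheory.Lp.coeFn_compMeasurePreserving ξ
    (MeasureTheory.measurePreserving_add_right MeasureTheory.volume s)

lemma translate_mul_neg (s : ℝ) : translate s * translate (-s) = 1 := by
  ext1 ξ
  refine MeasureTheory.Lp.ext ?_
  have h := (MeasureTheory.measurePreserving_add_right MeasureTheory.volume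
    s).quasiMeasurePreserving.ae_eq_comp (translate_apply (-s) ξ)
  filter_upwards [translate_apply s (translate (-s) ξ), h] with x h1 h2
  rw [mul_apply_eq_comp, h1]
  simpa using h2

lemma inner_translate (s : ℝ) (ξ η : LTwo) :
    inner ℂ (translate s ξ) (translate s η) = inner ℂ ξ η := by
  let T : LTwo →ₗᵢ[ℂ] LTwo :=
    { toLinearMap := (translate s).toLinearMap
      norm_map' := fun ξ => MeasureTheory.Lp.norm_compMeasurePreserving ξ
        (MeasureTheory.measurePreserving_add_right MeasureTheory.volume s) }
  exact T.inner_map_map ξ η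

lemma star_translate (s : ℝ) : star (translate s) = translate (-s) := by
  symm
  rw [ContinuousLinearMap.star_eq_adjoint, ContinuousLinearMap.eq_adjoint_iff]
  intro ξ η
  have h1 : ξ = translate s (translate (-s) ξ) := by
    rw [← mul_apply_eq_comp, translate_mul_neg]; rfl
  conv_rhs => rw [h1]
  exact (inner_translate s _ _).symm

lemma translate_mul_mulChar (s t : ℝ) : translate s * mulChar t * translate (-s) =
    Complex.exp (2 * Real.pi * Complex.I * (t * s : ℝ)) • mulChar t := by
  have key : translate s * mulChar t =
      Complex.exp (2 * Real.pi * Complex.I * (t * s : ℝ)) • (mulChar t * translate s) := by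
    ext1 ξ
    refine MeasureTheory.Lp.ext ?_
    have h := (MeasureTheory.measurePreserving_add_right MeasureTheory.volume
      s).quasiMeasurePreserving.ae_eq_comp (mulChar_apply t ξ)
    rw [smul_apply]
    filter_upwards [translate_apply s (mulChar t ξ), h, translate_apply s ξ,
      mulChar_apply t (translate s ξ), MeasureTheory.Lp.coeFn_smul
      (Complex.exp (2 * Real.pi * Complex.I * (t * s : ℝ))) ((mulChar t * translate s) ξ)]
      with x h1 h2 h3 h4 h5
    rw [mul_apply_eq_comp, h1, h5, Pi.smul_apply, mul_apply_eq_comp, h4, h3, smul_eq_mul]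
    simp only [Function.comp_apply] at h2
    rw [h2, ← mul_assoc, ← Complex.exp_add]
    push_cast
    ring_nf
  rw [key, smul_mul_assoc, mul_assoc (mulChar t), translate_mul_neg, mul_one]

end LTwo

/-! ### The covering algebra -/

/-- The Hilbert space `ℓ²(ℕ) ⊗ L²(ℝ)`. -/
abbrev SUqSpace : Type := HilbertTensor EllTwo LTwo

namespace SUq

variable (q : Set.Ioo (0 : ℝ) 1)

/-- The diagonal operator `e_k ↦ t^k e_k` on `ℓ²(ℕ)`, for `0 ≤ t ≤ 1`. -/
def powDiag (t : Set.Icc (0 : ℝ) 1) : EllTwo →L[ℂ] EllTwo :=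
  EllTwo.diag (fun k => ((t : ℝ) ^ k : ℝ)) (fun k => by
    rw [Complex.norm_real, Real.norm_of_nonneg (pow_nonneg t.2.1 k)]
    exact pow_le_one₀ t.2.1 t.2.2)

/-- The `n`-th root of `q`. -/
def root (n : ℕ) : Set.Icc (0 : ℝ) 1 :=
  ⟨(q : ℝ) ^ (1 / n : ℝ), Real.rpow_nonneg q.2.1.le _,
    Real.rpow_le_one q.2.1.le q.2.2.le (by positivity)⟩

/-- The operator `Q e_k = q^k e_k` on `ℓ²(ℕ)`. -/
def opQ : EllTwo →L[ℂ] EllTwo := powDiag ⟨q, q.2.1.le, q.2.2.le⟩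

/-- The operator `√(1 - Q²)` on `ℓ²(ℕ)`, that is `e_k ↦ √(1 - q^(2k)) e_k`. -/
def opSqrt : EllTwo →L[ℂ] EllTwo :=
  EllTwo.diag (fun k => (√(1 - (q : ℝ) ^ (2 * k)) : ℝ)) (fun k => by
    rw [Complex.norm_real, Real.norm_of_nonneg (Real.sqrt_nonneg _), Real.sqrt_le_one]
    have := pow_nonneg q.2.1.le (2 * k)
    linarith)

/-- The image `S √(1 - Q²) ⊗ 1` of `α` in the bounded operators on `ℓ²(ℕ) ⊗ L²(ℝ)`. -/
def opα : SUqSpace →L[ℂ] SUqSpace := opTensor (EllTwo.shift * opSqrt q) 1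

/-- The image `Q ⊗ R` of `β` in the bounded operators on `ℓ²(ℕ) ⊗ L²(ℝ)`, where
`R ξ = e^{2πix} ξ`. -/
def opβ : SUqSpace →L[ℂ] SUqSpace := opTensor (opQ q) (LTwo.mulChar 1)

lemma star_opSqrt : star (opSqrt q) = opSqrt q :=
  EllTwo.star_diag _ fun _ => Complex.conj_ofReal _

lemma star_powDiag (t : Set.Icc (0 : ℝ) 1) : star (powDiag t) = powDiag t :=
  EllTwo.star_diag _ fun _ => Complex.conj_ofReal _

lemma sqrt_mul_sqrt (k : ℕ) : ((√(1 - (q : ℝ) ^ (2 * k)) : ℝ) : ℂ) *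
    ((√(1 - (q : ℝ) ^ (2 * k)) : ℝ) : ℂ) = 1 - ((q : ℝ) : ℂ) ^ (2 * k) := by
  rw [← Complex.ofReal_mul, Real.mul_self_sqrt]
  · push_cast; ring
  · have := pow_le_one₀ (n := 2 * k) q.2.1.le q.2.2.le
    linarith

lemma op_relations : SUqRelations q (opα q) (opβ q) := by
  have sα : star (opα q) = opTensor (opSqrt q * EllTwo.unshift) 1 := by
    rw [opα, star_opTensor, star_mul, star_opSqrt, EllTwo.star_shift, star_one]
  have sβ : star (opβ q) = opTensor (opQ q) (LTwo.mulChar (-1)) := by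
    rw [opβ, star_opTensor, LTwo.star_mulChar, opQ, star_powDiag]
  have e : ∀ {S T : EllTwo →L[ℂ] EllTwo}, (∀ f k, S f k = T f k) → S = T := fun h => by
    ext f k
    exact h f k
  refine ⟨?_, ?_, ?_, ?_, ?_⟩
  · rw [sα, sβ, opα, opβ, opTensor_mul, opTensor_mul, LTwo.mulChar_mul, neg_add_cancel,
      LTwo.mulChar_zero, mul_one, ← opTensor_add_left, ← opTensor_one]
    congr 1
    refine e fun f k => ?_
    rcases k with _ | k
    · change ((√(1 - (q : ℝ) ^ (2 * 0)) : ℝ) : ℂ) * 0 +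
        (((q : ℝ) ^ 0 : ℝ) : ℂ) * ((((q : ℝ) ^ 0 : ℝ) : ℂ) * f 0) = f 0
      simp
    · change ((√(1 - (q : ℝ) ^ (2 * (k + 1))) : ℝ) : ℂ) *
        (((√(1 - (q : ℝ) ^ (2 * (k + 1))) : ℝ) : ℂ) * f (k + 1)) +
        (((q : ℝ) ^ (k + 1) : ℝ) : ℂ) * ((((q : ℝ) ^ (k + 1) : ℝ) : ℂ) * f (k + 1)) = f (k + 1)
      rw [← mul_assoc, sqrt_mul_sqrt]
      push_cast
      ring
  · rw [sα, sβ, opα, opβ, opTensor_mul, opTensor_mul, LTwo.mulChar_mul, add_neg_cancel,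
      LTwo.mulChar_zero, mul_one, ← opTensor_smul_left, ← opTensor_add_left, ← opTensor_one]
    congr 1
    refine e fun f k => ?_
    change ((√(1 - (q : ℝ) ^ (2 * (k + 1))) : ℝ) : ℂ) *
      (((√(1 - (q : ℝ) ^ (2 * (k + 1))) : ℝ) : ℂ) * f k) + ((q : ℝ) : ℂ) ^ 2 *
        ((((q : ℝ) ^ k : ℝ) : ℂ) * ((((q : ℝ) ^ k : ℝ) : ℂ) * f k)) = f k
    rw [← mul_assoc, sqrt_mul_sqrt]
    push_cast
    ring
  · rw [opα, opβ, opTensor_mul, opTensor_mul, one_mul, mul_one, ← opTensor_smul_left]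
    congr 1
    refine e fun f k => ?_
    change ((√(1 - (q : ℝ) ^ (2 * (k + 1))) : ℝ) : ℂ) *
      ((((q : ℝ) ^ (k + 1) : ℝ) : ℂ) * f (k + 1)) = ((q : ℝ) : ℂ) * ((((q : ℝ) ^ k : ℝ) : ℂ) *
        (((√(1 - (q : ℝ) ^ (2 * (k + 1))) : ℝ) : ℂ) * f (k + 1)))
    push_cast
    ring
  · rw [sβ, opα, opTensor_mul, opTensor_mul, one_mul, mul_one, ← opTensor_smul_left]
    congr 1
    refine e fun f k => ?_
    change ((√(1 - (q : ℝ) ^ (2 * (k + 1))) : ℝ) : ℂ) *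
      ((((q : ℝ) ^ (k + 1) : ℝ) : ℂ) * f (k + 1)) = ((q : ℝ) : ℂ) * ((((q : ℝ) ^ k : ℝ) : ℂ) *
        (((√(1 - (q : ℝ) ^ (2 * (k + 1))) : ℝ) : ℂ) * f (k + 1)))
    push_cast
    ring
  · rw [sβ, opβ, opTensor_mul, opTensor_mul, LTwo.mulChar_mul, LTwo.mulChar_mul, neg_add_cancel,
      add_neg_cancel]

/-- The representation of `C(SU_q(2))` on `ℓ²(ℕ) ⊗ L²(ℝ)` with `α ↦ S √(1 - Q²) ⊗ 1` and
`β ↦ Q ⊗ R`. -/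
def rep : SUq q →⋆ₐ[ℂ] (SUqSpace →L[ℂ] SUqSpace) := lift (op_relations q)

variable (n : ℕ)

/-- The operator `∑ k, q^(k/n) p_k ⊗ R^(1/n)` on `ℓ²(ℕ) ⊗ L²(ℝ)`, where `p_k` is the projection onto
`e_k` and `R^(1/n) ξ = e^{2πix/n} ξ`. -/
def opRoot : SUqSpace →L[ℂ] SUqSpace := opTensor (powDiag (root q n)) (LTwo.mulChar (1 / n))

/-- The C⋆-algebra of operators generated by `C(SU_q(2))` and the `n`-th root of `β`. -/
def coverSubalgebra : StarSubalgebra ℂ (SUqSpace →L[ℂ] SUqSpace) :=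
  (StarAlgebra.adjoin ℂ (Set.range (rep q) ∪ {opRoot q n})).topologicalClosure

end SUq

/-- The covering algebra `C(SU_q(2))[β̃]`. -/
def SUqCover (q : Set.Ioo (0 : ℝ) 1) (n : ℕ) : Type := SUq.coverSubalgebra q n

namespace SUqCover

variable (q : Set.Ioo (0 : ℝ) 1) (n : ℕ)

instance : CStarAlgebra (SUqCover q n) :=
  StarSubalgebra.cstarAlgebra (SUq.coverSubalgebra q n)
    (h_closed := StarSubalgebra.isClosed_topologicalClosure _)

/-- The inclusion of the covering algebra into the bounded operators. -/
def val : SUqCover q n →⋆ₐ[ℂ] (SUqSpace →L[ℂ] SUqSpace) := (SUq.coverSubalgebra q n).subtype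

end SUqCover

lemma FreeStarAlgebra.hom_ext {X : Type*} {B : Type*} [Ring B] [Algebra ℂ B] [StarRing B]
    {φ ψ : FreeStarAlgebra X →⋆ₐ[ℂ] B} (h : ∀ x, φ (gen x) = ψ (gen x)) (a : FreeStarAlgebra X) :
    φ a = ψ a := by
  induction a using FreeStarAlgebra.induction with
  | h0 c => rw [AlgHomClass.commutes, AlgHomClass.commutes]
  | h1 y =>
    rcases y with ⟨x, _ | _⟩
    · exact h x
    · have hx : (letter (x, true) : FreeStarAlgebra X) = star (gen x) :=
        (star_letter (x, false)).symm
      rw [hx, map_star, map_star, h]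
  | hm a b ha hb => rw [map_mul, map_mul, ha, hb]
  | ha a b ha hb => rw [map_add, map_add, ha, hb]

lemma continuous_starAlgHom {A B : Type*} [CStarAlgebra A] [CStarAlgebra B] (φ : A →⋆ₐ[ℂ] B) :
    Continuous φ :=
  AddMonoidHomClass.continuous_of_bound φ 1 fun x => by
    rw [one_mul]
    exact NonUnitalStarAlgHom.norm_apply_le φ x

namespace SUq

lemma hom_ext {q : ℝ} {B : Type*} [CStarAlgebra B] {φ ψ : SUq q →⋆ₐ[ℂ] B}
    (hα : φ (α q) = ψ (α q)) (hβ : φ (β q) = ψ (β q)) (x : SUq q) : φ x = ψ x := by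
  have hφ := continuous_starAlgHom φ
  have hψ := continuous_starAlgHom ψ
  refine congrFun ((denseRange_of q).equalizer hφ hψ (funext fun a => ?_)) x
  refine FreeStarAlgebra.hom_ext (φ := φ.comp (of q)) (ψ := ψ.comp (of q)) (fun i => ?_) a
  cases i
  · exact hα
  · exact hβ

end SUq

namespace SUqCover

variable (q : Set.Ioo (0 : ℝ) 1) (n : ℕ)

lemma val_mem (x : SUqCover q n) : val q n x ∈ SUq.coverSubalgebra q n := Subtype.property x

lemma val_injective : Function.Injective (val q n) := Subtype.val_injective

/-- An operator in the covering algebra, as an element of it. -/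
def mk (x : SUqSpace →L[ℂ] SUqSpace) (hx : x ∈ SUq.coverSubalgebra q n) : SUqCover q n := ⟨x, hx⟩

lemma rep_mem (a : SUq q) : SUq.rep q a ∈ SUq.coverSubalgebra q n :=
  StarSubalgebra.le_topologicalClosure _ (StarAlgebra.subset_adjoin ℂ _ (Or.inl ⟨a, rfl⟩))

lemma opRoot_mem : SUq.opRoot q n ∈ SUq.coverSubalgebra q n :=
  StarSubalgebra.le_topologicalClosure _ (StarAlgebra.subset_adjoin ℂ _ (Or.inr rfl))

/-- The inclusion of `C(SU_q(2))` into the covering algebra. -/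
def incl : SUq q →⋆ₐ[ℂ] SUqCover q n :=
  (SUq.rep q).codRestrict (SUq.coverSubalgebra q n) (rep_mem q n)

/-- The `n`-th root `β̃` of `β`. -/
def root : SUqCover q n := mk q n (SUq.opRoot q n) (opRoot_mem q n)

lemma root_pow (hn : n ≠ 0) : root q n ^ n = incl q n (SUq.β q) := by
  apply val_injective
  rw [map_pow]
  change SUq.opRoot q n ^ n = SUq.rep q (SUq.β q)
  rw [SUq.rep, SUq.lift_β, SUq.opβ, SUq.opRoot]
  have h1 : ∀ k : ℕ, opTensor (SUq.powDiag (SUq.root q n)) (LTwo.mulChar (1 / n)) ^ k =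
      opTensor (SUq.powDiag (SUq.root q n) ^ k) (LTwo.mulChar (k * (1 / n))) := by
    intro k
    induction k with
    | zero => simp [LTwo.mulChar_zero, opTensor_one]
    | succ k ih =>
      rw [pow_succ, ih, opTensor_mul, LTwo.mulChar_mul, pow_succ]
      congr 2
      push_cast
      ring
  have h2 : ∀ (k : ℕ) (f : EllTwo) (i : ℕ), (SUq.powDiag (SUq.root q n) ^ k) f i =
      ((((SUq.root q n : ℝ) ^ k) ^ i : ℝ) : ℂ) * f i := by
    intro k f i
    induction k generalizing f with
    | zero => simp
    | succ k ih =>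
      rw [pow_succ, mul_apply_eq_comp, ih]
      change _ * ((((SUq.root q n : ℝ) ^ i : ℝ) : ℂ) * f i) = _
      push_cast
      ring
  rw [h1]
  congr 1
  · ext f i
    rw [h2]
    have h3 : (SUq.root q n : ℝ) ^ n = q := by
      change ((q : ℝ) ^ (1 / n : ℝ)) ^ n = q
      rw [one_div, Real.rpow_inv_natCast_pow q.2.1.le hn]
    rw [h3]
    rfl
  · congr 1
    field_simp

/-! ### The action of `ℤ/n` -/

/-- The unitary `1 ⊗ T_s`, where `T_s` is the translation by `s`. -/
def translation (s : ℝ) : unitary (SUqSpace →L[ℂ] SUqSpace) :=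
  ⟨opTensor 1 (LTwo.translate s), by
    have h := LTwo.translate_mul_neg (-s)
    rw [neg_neg] at h
    rw [Unitary.mem_iff, star_opTensor, LTwo.star_translate, star_one, opTensor_mul, opTensor_mul,
      LTwo.translate_mul_neg, h, mul_one, opTensor_one]
    exact ⟨rfl, rfl⟩⟩

/-- Conjugation by `1 ⊗ T_s`. -/
def conj (s : ℝ) : (SUqSpace →L[ℂ] SUqSpace) →⋆ₐ[ℂ] (SUqSpace →L[ℂ] SUqSpace) :=
  (Unitary.conjStarAlgAut ℂ (SUqSpace →L[ℂ] SUqSpace) (translation s)).toStarAlgHom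

lemma conj_opTensor (s t : ℝ) (S : EllTwo →L[ℂ] EllTwo) :
    conj s (opTensor S (LTwo.mulChar t)) =
      Complex.exp (2 * Real.pi * Complex.I * (t * s : ℝ)) • opTensor S (LTwo.mulChar t) := by
  change opTensor 1 (LTwo.translate s) * opTensor S (LTwo.mulChar t) *
    star (opTensor 1 (LTwo.translate s)) = _
  rw [star_opTensor, LTwo.star_translate, star_one, opTensor_mul, opTensor_mul, one_mul, mul_one,
    LTwo.translate_mul_mulChar, opTensor_smul_right]

lemma exp_int_eq_one (m : ℕ) : Complex.exp (2 * Real.pi * Complex.I * (1 * m : ℝ)) = 1 := by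
  rw [Complex.exp_eq_one_iff]
  exact ⟨m, by push_cast; ring⟩

lemma conj_rep (m : ℕ) (a : SUq q) : conj m (SUq.rep q a) = SUq.rep q a := by
  refine SUq.hom_ext (φ := (conj m).comp (SUq.rep q)) (ψ := SUq.rep q) ?_ ?_ a
  · change conj m (SUq.rep q (SUq.α q)) = SUq.rep q (SUq.α q)
    rw [SUq.rep, SUq.lift_α, SUq.opα, ← LTwo.mulChar_zero, conj_opTensor]
    simp
  · change conj m (SUq.rep q (SUq.β q)) = SUq.rep q (SUq.β q)
    rw [SUq.rep, SUq.lift_β, SUq.opβ, conj_opTensor, exp_int_eq_one, one_smul]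

lemma conj_opRoot (s : ℝ) : conj s (SUq.opRoot q n) =
    Complex.exp (2 * Real.pi * Complex.I * (1 / n * s : ℝ)) • SUq.opRoot q n :=
  conj_opTensor s (1 / n) _

lemma map_closure_mem {C : Type*} [CStarAlgebra C] (φ : C →⋆ₐ[ℂ] C) {s : Set C}
    (h : ∀ x ∈ s, φ x ∈ (StarAlgebra.adjoin ℂ s).topologicalClosure) {x : C}
    (hx : x ∈ (StarAlgebra.adjoin ℂ s).topologicalClosure) :
    φ x ∈ (StarAlgebra.adjoin ℂ s).topologicalClosure := by
  have hc := continuous_starAlgHom φ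
  have hle : (StarAlgebra.adjoin ℂ s).topologicalClosure ≤
      (StarAlgebra.adjoin ℂ s).topologicalClosure.comap φ :=
    StarSubalgebra.topologicalClosure_minimal (StarAlgebra.adjoin_le h)
      ((StarSubalgebra.isClosed_topologicalClosure _).preimage hc)
  exact hle hx

lemma conj_mem (m : ℕ) {x : SUqSpace →L[ℂ] SUqSpace} (hx : x ∈ SUq.coverSubalgebra q n) :
    conj m x ∈ SUq.coverSubalgebra q n := by
  refine map_closure_mem (conj m) ?_ hx
  rintro _ (⟨a, rfl⟩ | rfl)
  · rw [conj_rep]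
    exact rep_mem q n a
  · rw [conj_opRoot]
    exact StarSubalgebra.smul_mem _ (opRoot_mem q n) _

/-- The action of `m ∈ ℤ/n` on the covering algebra, `a β̃^k ↦ e^{2πimk/n} a β̃^k`. It is implemented
by the translation `ξ(x) ↦ ξ(x + m)` of `L²(ℝ)`. -/
def deck (m : ZMod n) : SUqCover q n →⋆ₐ[ℂ] SUqCover q n :=
  ((conj m.val).comp (val q n)).codRestrict (SUq.coverSubalgebra q n)
    (fun x => conj_mem q n m.val (val_mem q n x))

lemma deck_incl (m : ZMod n) (a : SUq q) : deck q n m (incl q n a) = incl q n a :=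
  val_injective q n (conj_rep q m.val a)

lemma deck_root (m : ZMod n) : deck q n m (root q n) =
    Complex.exp (2 * Real.pi * Complex.I * m.val / n) • root q n := by
  apply val_injective q n
  rw [map_smul]
  refine (conj_opTensor m.val (1 / n) _).trans ?_
  congr 2
  push_cast
  ring

end SUqCover

end

/-!
The obstruction is topological and lies in the root `β̃` alone. The covering algebra has a family of
characters `χ_z`, for `z` in the unit circle, with `χ_z(α) = z` and `χ_z(β̃) = 0`
(`SUqCover.character`), and a representation `π` on `ℓ²(ℕ)` with `π(β) = Q`, the evaluation at
`0 ∈ ℝ` (`SUqCover.evalRep`). If `Δ'` extends the comultiplication, then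
`y_z = (π ⊗ χ_z)(Δ'(β̃))` satisfies
`y_z ^ n = (π ⊗ χ_z)(β ⊗ α + α⋆ ⊗ β) = z Q`. The vector `e_0` spans a simple eigenspace of `Q`, with
eigenvalue `1` (`SUq.mem_span_vacuum`), and `y_z` commutes with `Q`; hence `y_z e_0 = c(z) e_0` with
`c(z) ^ n = z`. Since `χ_z(b)` depends continuously on `z` for every `b`
(`SUqCover.continuous_character`), so does `y_z`, and `c` is a continuous `n`-th root on the circle.
For `n ≥ 2` there is none (`not_continuous_root_circle`).

Neither `π` nor `χ_z` is given by the universal property of `C(SU_q(2))`, because `β̃` is only given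
as an operator. Both are obtained as limits of compressions: if isometries `V_i : K → H` satisfy
`T V_i - V_i S → 0` strongly for the generators `T` of a C⋆-algebra of operators on `H`, and for
their adjoints, then `T ↦ S` extends to a representation on `K` (`approxRep`). For `π` the
isometries are `v ↦ v ⊗ ξ_i` with bumps `ξ_i` that concentrate at `0`; for `χ_z` they are given by
coherent states `∑ k, (r z) ^ k e_k` with `r → 1`, which are approximate eigenvectors of the shift
and drift to infinity, where `Q` vanishes.
-/

open scoped TensorProduct

noncomputable section
open Filter Topology

/-! ### Representations induced by asymptotically intertwining isometries -/

section ApproxIntertwiner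

variable {ι : Type*} {l : Filter ι}
variable {H K : Type*} [NormedAddCommGroup H] [InnerProductSpace ℂ H]
  [NormedAddCommGroup K] [InnerProductSpace ℂ K]

/-- The isometries `V i : K → H` intertwine the operators `T` on `H` and `S` on `K` asymptotically:
`T V i - V i S` tends to `0` strongly. -/
def ApproxIntertwines (l : Filter ι) (V : ι → K →ₗᵢ[ℂ] H) (T : H →L[ℂ] H) (S : K →L[ℂ] K) : Prop :=
  ∀ v, Tendsto (fun i => T (V i v) - V i (S v)) l (𝓝 0)

variable {V : ι → K →ₗᵢ[ℂ] H} {T T' : H →L[ℂ] H} {S S' : K →L[ℂ] K}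

namespace ApproxIntertwines

lemma add (h : ApproxIntertwines l V T S) (h' : ApproxIntertwines l V T' S') :
    ApproxIntertwines l V (T + T') (S + S') := fun v => by
  simpa [add_sub_add_comm] using (h v).add (h' v)

lemma mul (h : ApproxIntertwines l V T S) (h' : ApproxIntertwines l V T' S') :
    ApproxIntertwines l V (T * T') (S * S') := fun v => by
  have h1 := ((T.continuous.tendsto 0).comp (h' v)).add (h (S' v))
  simpa [Function.comp_def] using h1

lemma algebraMap (c : ℂ) : ApproxIntertwines l V (algebraMap ℂ _ c) (algebraMap ℂ _ c) :=
  fun v => by simp [Algebra.algebraMap_eq_smul_one, tendsto_const_nhds]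

lemma norm_le [l.NeBot] (h : ApproxIntertwines l V T S) : ‖S‖ ≤ ‖T‖ := by
  refine S.opNorm_le_bound (norm_nonneg _) fun v => ?_
  refine ge_of_tendsto' (x := l) (f := fun i => ‖T‖ * ‖v‖ + ‖T (V i v) - V i (S v)‖) ?_
    fun i => ?_
  · simpa using (tendsto_const_nhds (x := ‖T‖ * ‖v‖)).add (h v).norm
  · have h1 : ‖T (V i v)‖ ≤ ‖T‖ * ‖v‖ := by simpa using T.le_opNorm (V i v)
    have h2 := norm_sub_norm_le (V i (S v)) (T (V i v))
    rw [LinearIsometry.norm_map, norm_sub_rev] at h2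
    linarith

lemma isClosed (l : Filter ι) (V : ι → K →ₗᵢ[ℂ] H) :
    IsClosed {p : (H →L[ℂ] H) × (K →L[ℂ] K) | ApproxIntertwines l V p.1 p.2} := by
  refine isClosed_of_closure_subset fun p hp v => ?_
  rw [Metric.tendsto_nhds]
  intro ε hε
  obtain ⟨p', h', hd⟩ := Metric.mem_closure_iff.1 hp (ε / (4 * (‖v‖ + 1))) (by positivity)
  filter_upwards [Metric.tendsto_nhds.1 (h' v) (ε / 2) (by positivity)] with i hi
  rw [dist_zero_right] at hi ⊢
  rw [Prod.dist_eq, max_lt_iff, dist_eq_norm, dist_eq_norm, lt_div_iff₀ (by positivity),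
    lt_div_iff₀ (by positivity)] at hd
  have e : p.1 (V i v) - V i (p.2 v) = (p.1 - p'.1) (V i v) - V i ((p.2 - p'.2) v) +
      (p'.1 (V i v) - V i (p'.2 v)) := by
    simp only [sub_apply, map_sub]
    abel
  have h1 : ‖(p.1 - p'.1) (V i v)‖ ≤ ‖p.1 - p'.1‖ * ‖v‖ := by
    simpa using (p.1 - p'.1).le_opNorm (V i v)
  have h2 : ‖V i ((p.2 - p'.2) v)‖ ≤ ‖p.2 - p'.2‖ * ‖v‖ := by
    rw [LinearIsometry.norm_map]
    exact (p.2 - p'.2).le_opNorm v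
  rw [e]
  have h3 := norm_add_le ((p.1 - p'.1) (V i v) - V i ((p.2 - p'.2) v))
    (p'.1 (V i v) - V i (p'.2 v))
  have h4 := norm_sub_le ((p.1 - p'.1) (V i v)) (V i ((p.2 - p'.2) v))
  nlinarith [norm_nonneg (p.1 - p'.1), norm_nonneg (p.2 - p'.2)]

lemma sub (h : ApproxIntertwines l V T S) (h' : ApproxIntertwines l V T' S') :
    ApproxIntertwines l V (T - T') (S - S') := fun v => by
  simpa [sub_sub_sub_comm] using (h v).sub (h' v)

lemma unique [l.NeBot] (h : ApproxIntertwines l V T S) (h' : ApproxIntertwines l V T S') :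
    S = S' := by
  simpa [sub_eq_zero] using (h.sub h').norm_le

end ApproxIntertwines

variable [CompleteSpace H] [CompleteSpace K]

/-- The isometries `V i` asymptotically intertwine `T` and `S`, as well as `T⋆` and `S⋆`. -/
def StarIntertwines (l : Filter ι) (V : ι → K →ₗᵢ[ℂ] H) (T : H →L[ℂ] H) (S : K →L[ℂ] K) : Prop :=
  ApproxIntertwines l V T S ∧ ApproxIntertwines l V (star T) (star S)

namespace StarIntertwines

lemma add (h : StarIntertwines l V T S) (h' : StarIntertwines l V T' S') :
    StarIntertwines l V (T + T') (S + S') :=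
  ⟨h.1.add h'.1, by rw [star_add, star_add]; exact h.2.add h'.2⟩

lemma mul (h : StarIntertwines l V T S) (h' : StarIntertwines l V T' S') :
    StarIntertwines l V (T * T') (S * S') :=
  ⟨h.1.mul h'.1, by rw [star_mul, star_mul]; exact h'.2.mul h.2⟩

lemma algebraMap (c : ℂ) : StarIntertwines l V (algebraMap ℂ _ c) (algebraMap ℂ _ c) :=
  ⟨.algebraMap c, by
    rw [← algebraMap_star_comm, ← algebraMap_star_comm]; exact .algebraMap (star c)⟩

lemma star (h : StarIntertwines l V T S) : StarIntertwines l V (star T) (star S) :=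
  ⟨h.2, by rw [star_star, star_star]; exact h.1⟩

lemma isClosed (l : Filter ι) (V : ι → K →ₗᵢ[ℂ] H) :
    IsClosed {p : (H →L[ℂ] H) × (K →L[ℂ] K) | StarIntertwines l V p.1 p.2} := by
  have h1 : Continuous fun p : (H →L[ℂ] H) × (K →L[ℂ] K) => Star.star p.1 :=
    continuous_star.comp continuous_fst
  have h2 : Continuous fun p : (H →L[ℂ] H) × (K →L[ℂ] K) => Star.star p.2 :=
    continuous_star.comp continuous_snd
  exact (ApproxIntertwines.isClosed l V).inter
    ((ApproxIntertwines.isClosed l V).preimage (h1.prodMk h2))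

end StarIntertwines

/-- The operators on `H` that have an asymptotic compression to `K` along the isometries `V i`. -/
def approxDomain (l : Filter ι) (V : ι → K →ₗᵢ[ℂ] H) : StarSubalgebra ℂ (H →L[ℂ] H) where
  carrier := {T | ∃ S, StarIntertwines l V T S}
  mul_mem' := fun ⟨_, h⟩ ⟨_, h'⟩ => ⟨_, h.mul h'⟩
  add_mem' := fun ⟨_, h⟩ ⟨_, h'⟩ => ⟨_, h.add h'⟩
  algebraMap_mem' c := ⟨_, .algebraMap c⟩
  star_mem' := fun ⟨_, h⟩ => ⟨_, h.star⟩

lemma mem_approxDomain : T ∈ approxDomain l V ↔ ∃ S, StarIntertwines l V T S := Iff.rfl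

/-- Compressions do not increase the norm, so the projection of the graph of the compression onto
its domain is isometric; hence the domain is complete. -/
lemma isClosed_approxDomain [l.NeBot] (V : ι → K →ₗᵢ[ℂ] H) :
    IsClosed (approxDomain l V : Set (H →L[ℂ] H)) := by
  let G : Set ((H →L[ℂ] H) × (K →L[ℂ] K)) := {p | StarIntertwines l V p.1 p.2}
  have hi : Isometry fun p : G => p.1.1 := by
    refine Isometry.of_dist_eq fun p p' => ?_
    have h := (p.2.1.sub p'.2.1).norm_le
    rw [Subtype.dist_eq, Prod.dist_eq, dist_eq_norm, dist_eq_norm]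
    exact (max_eq_left h).symm
  have : CompleteSpace G := (StarIntertwines.isClosed l V).completeSpace_coe
  have h : (approxDomain l V : Set (H →L[ℂ] H)) = Set.range fun p : G => p.1.1 := by
    ext T
    exact ⟨fun ⟨S, h⟩ => ⟨⟨(T, S), h⟩, rfl⟩, fun ⟨⟨⟨_, S⟩, h⟩, e⟩ => ⟨S, e ▸ h⟩⟩
  rw [h]
  exact hi.isClosedEmbedding.isClosed_range

/-- The asymptotic compression of an operator in the domain. -/
def approxCompression (V : ι → K →ₗᵢ[ℂ] H) (T : approxDomain l V) : K →L[ℂ] K :=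
  (mem_approxDomain.1 T.2).choose

lemma starIntertwines_approxCompression (T : approxDomain l V) :
    StarIntertwines l V (T : H →L[ℂ] H) (approxCompression V T) :=
  (mem_approxDomain.1 T.2).choose_spec

lemma approxCompression_eq [l.NeBot] {T : approxDomain l V}
    (h : StarIntertwines l V (T : H →L[ℂ] H) S) : approxCompression V T = S :=
  (starIntertwines_approxCompression T).1.unique h.1

lemma approxCompression_algebraMap [l.NeBot] (c : ℂ) :
    approxCompression V (algebraMap ℂ (approxDomain l V) c) = algebraMap ℂ _ c :=
  approxCompression_eq (StarIntertwines.algebraMap (l := l) (V := V) c)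

lemma approxCompression_mul [l.NeBot] (T T' : approxDomain l V) :
    approxCompression V (T * T') = approxCompression V T * approxCompression V T' :=
  approxCompression_eq
    ((starIntertwines_approxCompression T).mul (starIntertwines_approxCompression T'))

lemma approxCompression_add [l.NeBot] (T T' : approxDomain l V) :
    approxCompression V (T + T') = approxCompression V T + approxCompression V T' :=
  approxCompression_eq
    ((starIntertwines_approxCompression T).add (starIntertwines_approxCompression T'))

lemma approxCompression_star [l.NeBot] (T : approxDomain l V) :
    approxCompression V (star T) = star (approxCompression V T) :=
  approxCompression_eq (starIntertwines_approxCompression T).star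

/-- The representation on `K` that the isometries `V i` asymptotically induce on their domain. -/
def approxRep [l.NeBot] (V : ι → K →ₗᵢ[ℂ] H) : approxDomain l V →⋆ₐ[ℂ] (K →L[ℂ] K) where
  __ := AlgHom.ofLinearMap
    { toFun := approxCompression V
      map_add' := approxCompression_add
      map_smul' := fun c T => by
        rw [Algebra.smul_def, approxCompression_mul, approxCompression_algebraMap,
          ← Algebra.smul_def, RingHom.id_apply] }
    ((congrArg _ (map_one _).symm).trans <|
      (approxCompression_algebraMap 1).trans (map_one _)) approxCompression_mul
  map_star' := approxCompression_star

lemma approxRep_eq [l.NeBot] {T : approxDomain l V} (h : StarIntertwines l V T S) :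
    approxRep V T = S :=
  approxCompression_eq h

end ApproxIntertwiner

/-! ### Continuous families and roots on the circle -/

/-- The elements on which a family of ⋆-homomorphisms depends continuously on the parameter. -/
def continuousStarSubalgebra {Z A B : Type*} [TopologicalSpace Z] [CStarAlgebra A] [CStarAlgebra B]
    (φ : Z → A →⋆ₐ[ℂ] B) : StarSubalgebra ℂ A where
  carrier := {a | Continuous fun z => φ z a}
  mul_mem' {a b} (h : Continuous _) (h' : Continuous _) := by
    simpa only [Set.mem_ofPred_eq, map_mul] using! h.mul h'
  add_mem' {a b} (h : Continuous _) (h' : Continuous _) := by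
    simpa only [Set.mem_ofPred_eq, map_add] using! h.add h'
  algebraMap_mem' c := by
    simpa only [Set.mem_ofPred_eq, AlgHomClass.commutes] using continuous_const
  star_mem' {a} (h : Continuous _) := by
    simpa only [Set.mem_ofPred_eq, map_star] using h.star

lemma isClosed_continuousStarSubalgebra {Z A B : Type*} [TopologicalSpace Z] [CStarAlgebra A]
    [CStarAlgebra B] (φ : Z → A →⋆ₐ[ℂ] B) : IsClosed (continuousStarSubalgebra φ : Set A) := by
  refine isClosed_of_closure_subset fun a ha => ?_
  refine continuous_of_uniform_approx_of_continuous ?_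
  rw [Metric.uniformity_basis_dist.forall_iff
    (fun _ _ h ⟨F, hF, h'⟩ => ⟨F, hF, fun y => h (h' y)⟩)]
  intro ε hε
  obtain ⟨b, hb, hd⟩ := Metric.mem_closure_iff.1 ha ε hε
  refine ⟨fun z => φ z b, hb, fun z => ?_⟩
  refine lt_of_le_of_lt ?_ hd
  rw [dist_eq_norm, dist_eq_norm, ← map_sub]
  exact NonUnitalStarAlgHom.norm_apply_le (φ z) _

/-- The circle has no continuous `n`-th root. -/
lemma not_continuous_root_circle {n : ℕ} (hn : 2 ≤ n) {c : Circle → ℂ} (hc : Continuous c)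
    (h : ∀ z, c z ^ n = z) : False := by
  have hn0 : n ≠ 0 := by omega
  have hnC : (n : ℂ) ≠ 0 := Nat.cast_ne_zero.2 hn0
  -- along `t ↦ e^{it}`, the root differs from `e^{it/n}` by a root of unity, a constant
  let g : ℝ → ℂ := fun t => c (Circle.exp t) * Complex.exp (-(t * Complex.I / n))
  have hg : Continuous g := by fun_prop
  have hgn : ∀ t, g t ∈ {x : ℂ | x ^ n = 1} := fun t => by
    change (c (Circle.exp t) * Complex.exp (-(t * Complex.I / n))) ^ n = 1
    rw [mul_pow, h, Circle.coe_exp, ← Complex.exp_nat_mul, ← Complex.exp_add]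
    convert Complex.exp_zero
    field_simp
    ring
  have hfin : {x : ℂ | x ^ n = 1}.Finite := by
    refine (Polynomial.nthRootsFinset n (1 : ℂ)).finite_toSet.subset fun x hx => ?_
    rw [Finset.mem_coe, Polynomial.mem_nthRootsFinset (by omega)]
    exact hx
  have hsub : (g '' Set.univ).Subsingleton := hfin.countable.isTotallyDisconnected _
    (by rintro _ ⟨t, _, rfl⟩; exact hgn t) (isPreconnected_univ.image g hg.continuousOn)
  have h0 : g (2 * Real.pi) = g 0 := hsub ⟨_, trivial, rfl⟩ ⟨_, trivial, rfl⟩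
  have hc0 : c 1 ≠ 0 := fun h' => by
    have := h 1
    rw [h', zero_pow hn0] at this
    simp at this
  simp only [g, Circle.exp_two_pi, Circle.exp_zero] at h0
  have h1 := mul_left_cancel₀ hc0 h0
  push_cast at h1
  rw [zero_mul, zero_div, neg_zero, Complex.exp_zero, Complex.exp_eq_one_iff] at h1
  obtain ⟨m, hm⟩ := h1
  have hpi : (2 * Real.pi * Complex.I : ℂ) ≠ 0 := Complex.two_pi_I_ne_zero
  have h2 : (m : ℂ) * n = -1 := by
    field_simp at hm
    have : (2 * Real.pi * Complex.I : ℂ) * (m * n) = 2 * Real.pi * Complex.I * (-1) := by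
      linear_combination -(2 * Real.pi * Complex.I : ℂ) * hm
    exact mul_left_cancel₀ hpi this
  have h3 : m * n = -1 := by exact_mod_cast h2
  have h4 : (n : ℤ) ∣ 1 := ⟨-m, by linarith⟩
  have := Int.le_of_dvd one_pos h4
  omega

/-! ### Evaluation at a point of the line -/

namespace LTwo

/-- The normalized indicator functions of `[0, 1/(i+1)]` are asymptotically fixed by all
multiplications by characters: evaluation at `0` is approximated by unit vectors. -/
lemma exists_unit_mulChar_sub_le (i : ℕ) : ∃ ξ : LTwo, ‖ξ‖ = 1 ∧
    ∀ t, ‖mulChar t ξ - ξ‖ ≤ 2 * Real.pi * |t| * (1 / ((i : ℝ) + 1)) := by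
  have hi : 0 < 1 / ((i : ℝ) + 1) := by positivity
  set ε := 1 / ((i : ℝ) + 1)
  have hfin : MeasureTheory.volume (Set.Icc 0 ε) ≠ ⊤ := by simp
  let χ : LTwo := MeasureTheory.indicatorConstLp 2 measurableSet_Icc hfin (1 : ℂ)
  have hχ : 0 < ‖χ‖ := by
    rw [MeasureTheory.norm_indicatorConstLp (by norm_num) (by norm_num)]
    simp only [norm_one, one_mul, Real.volume_real_Icc, sub_zero, max_eq_left hi.le]
    positivity
  have hb : ∀ t, ‖mulChar t χ - χ‖ ≤ 2 * Real.pi * |t| * ε * ‖χ‖ := fun t => by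
    refine MeasureTheory.Lp.norm_le_mul_norm_of_ae_le_mul ?_
    filter_upwards [MeasureTheory.Lp.coeFn_sub (mulChar t χ) χ, mulChar_apply t χ,
      MeasureTheory.indicatorConstLp_coeFn (p := 2) (hs := measurableSet_Icc) (hμs := hfin)
        (c := (1 : ℂ))] with x h1 h2 h3
    rw [h1, Pi.sub_apply, h2]
    change χ x = _ at h3
    rw [h3]
    by_cases hx : x ∈ Set.Icc 0 ε
    · rw [Set.indicator_of_mem hx, mul_one, norm_one, mul_one]
      have h4 : 2 * (Real.pi : ℂ) * Complex.I * (t * x : ℝ) =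
          Complex.I * (2 * Real.pi * (t * x) : ℝ) := by
        push_cast
        ring
      rw [h4]
      refine Real.norm_exp_I_mul_ofReal_sub_one_le.trans ?_
      rw [Real.norm_eq_abs, abs_mul, abs_of_pos Real.two_pi_pos, abs_mul, abs_of_nonneg hx.1,
        ← mul_assoc]
      gcongr
      exact hx.2
    · rw [Set.indicator_of_notMem hx]
      simp
  refine ⟨((‖χ‖⁻¹ : ℝ) : ℂ) • χ, ?_, fun t => ?_⟩
  · rw [norm_smul, Complex.norm_real, norm_inv, norm_norm, inv_mul_cancel₀ hχ.ne']
  · rw [map_smul, ← smul_sub, norm_smul, Complex.norm_real, norm_inv, norm_norm,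
      inv_mul_le_iff₀ hχ, mul_comm ‖χ‖]
    exact hb t

/-- Unit vectors concentrating at `0`. -/
def bump (i : ℕ) : LTwo := (exists_unit_mulChar_sub_le i).choose

lemma norm_bump (i : ℕ) : ‖bump i‖ = 1 := (exists_unit_mulChar_sub_le i).choose_spec.1

lemma tendsto_mulChar_bump (t : ℝ) :
    Tendsto (fun i => ‖mulChar t (bump i) - bump i‖) atTop (𝓝 0) := by
  refine squeeze_zero (fun _ => norm_nonneg _)
    (fun i => (exists_unit_mulChar_sub_le i).choose_spec.2 t) ?_
  simpa using (tendsto_one_div_add_atTop_nhds_zero_nat (𝕜 := ℝ)).const_mul (2 * Real.pi * |t|)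

end LTwo

namespace HilbertTensor

variable {H K : Type*} [NormedAddCommGroup H] [InnerProductSpace ℂ H]
  [NormedAddCommGroup K] [InnerProductSpace ℂ K]

lemma norm_coe_tmul (v : H) (w : K) : ‖coe (v ⊗ₜ[ℂ] w)‖ = ‖v‖ * ‖w‖ := by
  rw [LinearIsometry.norm_map, TensorProduct.norm_tmul]

/-- The isometry `v ↦ v ⊗ ξ`, for a unit vector `ξ`. -/
def tmulRight (ξ : K) (hξ : ‖ξ‖ = 1) : H →ₗᵢ[ℂ] HilbertTensor H K where
  toLinearMap := coe.toLinearMap ∘ₗ (TensorProduct.mk ℂ H K).flip ξ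
  norm_map' v := (norm_coe_tmul v ξ).trans (by rw [hξ, mul_one])

lemma tmulRight_apply (ξ : K) (hξ : ‖ξ‖ = 1) (v : H) : tmulRight ξ hξ v = coe (v ⊗ₜ[ℂ] ξ) := rfl

lemma opTensor_coe_tmul (S : H →L[ℂ] H) (T : K →L[ℂ] K) (v : H) (w : K) :
    opTensor S T (coe (v ⊗ₜ[ℂ] w)) = coe (S v ⊗ₜ[ℂ] T w) := by
  rw [opTensor_coe, TensorProduct.mapL_tmul]

end HilbertTensor

open HilbertTensor

/-- Multiplication by a character becomes the identity when evaluated at `0`. -/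
lemma starIntertwines_bump (S : EllTwo →L[ℂ] EllTwo) (t : ℝ) :
    StarIntertwines atTop (fun i => tmulRight (LTwo.bump i) (LTwo.norm_bump i))
      (opTensor S (LTwo.mulChar t)) S := by
  have h : ∀ (S : EllTwo →L[ℂ] EllTwo) (t : ℝ),
      ApproxIntertwines atTop (fun i => tmulRight (LTwo.bump i) (LTwo.norm_bump i))
      (opTensor S (LTwo.mulChar t)) S := fun S t v => by
    rw [tendsto_zero_iff_norm_tendsto_zero]
    simp only [tmulRight_apply, opTensor_coe_tmul, ← map_sub, ← TensorProduct.tmul_sub,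
      norm_coe_tmul]
    simpa using (LTwo.tendsto_mulChar_bump t).const_mul ‖S v‖
  refine ⟨h S t, ?_⟩
  rw [star_opTensor, LTwo.star_mulChar]
  exact h _ _

/-! ### Characters at infinity -/

namespace EllTwo

/-- The square-summable sequence `1, a, a², …`. -/
def geom (a : ℂ) (ha : ‖a‖ < 1) : EllTwo :=
  ⟨fun k => a ^ k, memℓp_gen <| by
    have h := summable_geometric_of_lt_one (sq_nonneg ‖a‖) (by nlinarith [norm_nonneg a])
    refine h.congr fun k => ?_
    rw [ENNReal.toReal_ofNat, Real.rpow_ofNat, norm_pow, ← pow_mul, ← pow_mul, mul_comm]⟩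

lemma geom_apply (a : ℂ) (ha : ‖a‖ < 1) (k : ℕ) : geom a ha k = a ^ k := rfl

lemma norm_geom_sq (a : ℂ) (ha : ‖a‖ < 1) : ‖geom a ha‖ ^ 2 = (1 - ‖a‖ ^ 2)⁻¹ := by
  have h := lp.norm_rpow_eq_tsum (p := 2) (by norm_num) (geom a ha)
  simp only [ENNReal.toReal_ofNat, Real.rpow_ofNat, geom_apply, norm_pow] at h
  rw [h, ← tsum_geometric_of_lt_one (sq_nonneg ‖a‖) (by nlinarith [norm_nonneg a])]
  exact tsum_congr fun k => by rw [← pow_mul, ← pow_mul, mul_comm]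

lemma shift_geom (a : ℂ) (ha : ‖a‖ < 1) : shift (geom a ha) = a • geom a ha := by
  ext k
  exact pow_succ' a k

lemma norm_shift_le : ‖shift‖ ≤ 1 := by
  unfold shift
  exact LinearMap.mkContinuous_norm_le _ zero_le_one _

/-- The modulus of the `i`-th approximate eigenvalue; it tends to `1`. -/
def radius (i : ℕ) : ℝ := √(1 - 1 / ((i : ℝ) + 1))

lemma radius_nonneg (i : ℕ) : 0 ≤ radius i := Real.sqrt_nonneg _

lemma radius_sq (i : ℕ) : radius i ^ 2 = 1 - 1 / ((i : ℝ) + 1) := by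
  refine Real.sq_sqrt (sub_nonneg.2 ?_)
  rw [div_le_one (by positivity)]
  linarith [(Nat.cast_nonneg i : (0 : ℝ) ≤ i)]

lemma radius_lt_one (i : ℕ) : radius i < 1 := by
  have h := radius_sq i
  have : 0 < 1 / ((i : ℝ) + 1) := by positivity
  nlinarith [radius_nonneg i]

lemma tendsto_radius : Tendsto radius atTop (𝓝 1) := by
  have h := (tendsto_one_div_add_atTop_nhds_zero_nat (𝕜 := ℝ)).const_sub 1
  have h' := (Real.continuous_sqrt.tendsto _).comp h
  rwa [sub_zero, Real.sqrt_one] at h'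

variable (z : Circle)

lemma norm_radius_mul (i : ℕ) : ‖(radius i : ℂ) * z‖ = radius i := by
  rw [norm_mul, Circle.norm_coe, mul_one, Complex.norm_real, Real.norm_of_nonneg (radius_nonneg i)]

/-- The coherent states `√(1 - r²) ∑ k, (r z)^k e_k`, with `r → 1`: exact eigenvectors of the shift
with eigenvalues `r z`, which drift to infinity. -/
def coherent (i : ℕ) : EllTwo :=
  ((√(1 / ((i : ℝ) + 1)) : ℝ) : ℂ) •
    geom (radius i * z) ((norm_radius_mul z i).trans_lt (radius_lt_one i))

lemma norm_coherent (i : ℕ) : ‖coherent z i‖ = 1 := by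
  have h : (0 : ℝ) < 1 / ((i : ℝ) + 1) := by positivity
  rw [← sq_eq_sq₀ (norm_nonneg _) zero_le_one, coherent, norm_smul, mul_pow, norm_geom_sq,
    norm_radius_mul, radius_sq, Complex.norm_real, Real.norm_of_nonneg (Real.sqrt_nonneg _),
    Real.sq_sqrt h.le, sub_sub_cancel, one_pow, mul_inv_cancel₀ h.ne']

lemma shift_coherent (i : ℕ) : shift (coherent z i) = ((radius i : ℂ) * z) • coherent z i := by
  rw [coherent, map_smul, shift_geom, smul_comm]

lemma tendsto_shift_coherent :
    Tendsto (fun i => shift (coherent z i) - (z : ℂ) • coherent z i) atTop (𝓝 0) := by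
  rw [tendsto_zero_iff_norm_tendsto_zero]
  have h : ∀ i, ‖shift (coherent z i) - (z : ℂ) • coherent z i‖ = |radius i - 1| := fun i => by
    rw [shift_coherent, ← sub_smul, norm_smul, norm_coherent, mul_one, ← sub_one_mul, norm_mul,
      Circle.norm_coe, mul_one, ← Complex.ofReal_one, ← Complex.ofReal_sub, Complex.norm_real,
      Real.norm_eq_abs]
  simp only [h]
  simpa using (tendsto_radius.sub_const 1).abs

/-- Since the shift is a contraction, approximate eigenvectors for an eigenvalue of modulus one are
approximate eigenvectors of its adjoint. -/
lemma tendsto_star_shift_coherent :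
    Tendsto (fun i => star shift (coherent z i) - star (z : ℂ) • coherent z i) atTop (𝓝 0) := by
  have hle : ∀ i, ‖star shift (coherent z i) - star (z : ℂ) • coherent z i‖ ^ 2 ≤
      2 - 2 * radius i := fun i => by
    have h1 : ‖star shift (coherent z i)‖ ≤ 1 := by
      refine ((star shift).le_opNorm _).trans ?_
      rw [norm_coherent, mul_one, ContinuousLinearMap.star_eq_adjoint, LinearIsometryEquiv.norm_map]
      exact norm_shift_le
    have h2 : inner ℂ (star shift (coherent z i)) (star (z : ℂ) • coherent z i) = radius i := by
      rw [ContinuousLinearMap.star_eq_adjoint, ContinuousLinearMap.adjoint_inner_left, map_smul,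
        shift_coherent, smul_smul, inner_smul_right, inner_self_eq_norm_sq_to_K, norm_coherent]
      have h3 : star (z : ℂ) * z = 1 := by
        have := Circle.normSq_coe z
        rw [Complex.star_def, ← Complex.normSq_eq_conj_mul_self, this, Complex.ofReal_one]
      rw [mul_left_comm, h3]
      simp
    rw [@norm_sub_sq ℂ, h2, norm_smul, norm_coherent, norm_star, Circle.norm_coe]
    simp only [RCLike.re_to_complex, Complex.ofReal_re]
    nlinarith [norm_nonneg (star shift (coherent z i))]
  rw [tendsto_zero_iff_norm_tendsto_zero]
  have h4 : Tendsto (fun i => √(2 - 2 * radius i)) atTop (𝓝 0) := by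
    have h := (tendsto_radius.const_mul 2).const_sub 2
    have h5 := (Real.continuous_sqrt.tendsto _).comp h
    simpa using! h5
  exact squeeze_zero (fun _ => norm_nonneg _) (fun i => Real.le_sqrt_of_sq_le (hle i)) h4

/-- The coherent states drift to infinity: they are killed by diagonal operators that decay
geometrically. -/
lemma tendsto_powDiag_coherent {t : Set.Icc (0 : ℝ) 1} (ht : (t : ℝ) < 1) :
    Tendsto (fun i => SUq.powDiag t (coherent z i)) atTop (𝓝 0) := by
  have h0 := t.2.1
  have hle : ∀ i, ‖SUq.powDiag t (coherent z i)‖ ^ 2 ≤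
      1 / ((i : ℝ) + 1) * (1 - (t : ℝ) ^ 2)⁻¹ := fun i => by
    have hi : (0 : ℝ) < 1 / ((i : ℝ) + 1) := by positivity
    have hn : ‖(t : ℂ) * (radius i * z)‖ = t * radius i := by
      rw [norm_mul, norm_radius_mul, Complex.norm_real, Real.norm_of_nonneg h0]
    have hr := radius_nonneg i
    have hr' := radius_lt_one i
    have ha : ‖(t : ℂ) * (radius i * z)‖ < 1 := by
      rw [hn]
      nlinarith
    have e : SUq.powDiag t (coherent z i) =
        ((√(1 / ((i : ℝ) + 1)) : ℝ) : ℂ) • geom (t * (radius i * z)) ha := by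
      rw [coherent, map_smul]
      congr 1
      ext k
      change (((t : ℝ) ^ k : ℝ) : ℂ) * (radius i * z) ^ k = (t * (radius i * z)) ^ k
      rw [mul_pow (t : ℂ), Complex.ofReal_pow]
    rw [e, norm_smul, mul_pow, norm_geom_sq, hn, Complex.norm_real,
      Real.norm_of_nonneg (Real.sqrt_nonneg _), Real.sq_sqrt hi.le]
    gcongr
    · nlinarith
    · nlinarith
  rw [tendsto_zero_iff_norm_tendsto_zero]
  refine squeeze_zero (fun _ => norm_nonneg _) (fun i => Real.le_sqrt_of_sq_le (hle i)) ?_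
  have h := (tendsto_one_div_add_atTop_nhds_zero_nat (𝕜 := ℝ)).mul_const (1 - (t : ℝ) ^ 2)⁻¹
  have h5 := (Real.continuous_sqrt.tendsto _).comp h
  simpa using! h5

end EllTwo

namespace SUq

variable (q : Set.Ioo (0 : ℝ) 1) (z : Circle)

/-- At infinity the diagonal operator `√(1 - Q²)` becomes the identity, since `1 - √(1 - Q²) ≤ Q`. -/
lemma tendsto_opSqrt_coherent :
    Tendsto (fun i => opSqrt q (EllTwo.coherent z i) - EllTwo.coherent z i) atTop (𝓝 0) := by
  refine squeeze_zero_norm (fun i => ?_)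
    ((tendsto_zero_iff_norm_tendsto_zero).1
      (EllTwo.tendsto_powDiag_coherent z (t := ⟨q, q.2.1.le, q.2.2.le⟩) q.2.2))
  refine lp.norm_mono two_ne_zero fun k => ?_
  change ‖((√(1 - (q : ℝ) ^ (2 * k)) : ℝ) : ℂ) * EllTwo.coherent z i k - EllTwo.coherent z i k‖ ≤
    ‖(((q : ℝ) ^ k : ℝ) : ℂ) * EllTwo.coherent z i k‖
  rw [← sub_one_mul, norm_mul, norm_mul, ← Complex.ofReal_one, ← Complex.ofReal_sub,
    Complex.norm_real, Complex.norm_real]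
  gcongr
  have h0 : (0 : ℝ) ≤ (q : ℝ) ^ k := pow_nonneg q.2.1.le k
  have h1 : (q : ℝ) ^ k ≤ 1 := pow_le_one₀ q.2.1.le q.2.2.le
  rw [mul_comm 2 k, pow_mul]
  have h2 : √(1 - ((q : ℝ) ^ k) ^ 2) ≤ 1 := Real.sqrt_le_one.2 (by nlinarith)
  have h3 : 1 - (q : ℝ) ^ k ≤ √(1 - ((q : ℝ) ^ k) ^ 2) := Real.le_sqrt_of_sq_le (by nlinarith)
  rw [Real.norm_of_nonneg h0, Real.norm_of_nonpos (by linarith)]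
  linarith

/-- The isometry `c ↦ c (η ⊗ ξ)` of `ℂ`, where `η` is a coherent state and `ξ` a unit vector. -/
def coherentIsometry (i : ℕ) : ℂ →ₗᵢ[ℂ] SUqSpace :=
  LinearIsometry.toSpanSingleton ℂ SUqSpace
    (v := coe (EllTwo.coherent z i ⊗ₜ[ℂ] LTwo.bump 0)) (by
      rw [norm_coe_tmul, EllTwo.norm_coherent, LTwo.norm_bump, mul_one])

lemma coherentIsometry_apply (i : ℕ) (c : ℂ) :
    coherentIsometry z i c = c • coe (EllTwo.coherent z i ⊗ₜ[ℂ] LTwo.bump 0) := rfl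

variable {z} in
/-- The second tensor factor `T` may be arbitrary if `c = 0`, as `T ξ` is bounded. -/
lemma approxIntertwines_coherent {S : EllTwo →L[ℂ] EllTwo} {T : LTwo →L[ℂ] LTwo} {c : ℂ}
    (hT : T = 1 ∨ c = 0)
    (h : Tendsto (fun i => S (EllTwo.coherent z i) - c • EllTwo.coherent z i) atTop (𝓝 0)) :
    ApproxIntertwines atTop (coherentIsometry z) (opTensor S T) (c • 1) := fun v => by
  have e : ∀ i,
      opTensor S T (coherentIsometry z i v) - coherentIsometry z i ((c • 1 : ℂ →L[ℂ] ℂ) v) = v •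
        coe ((S (EllTwo.coherent z i) - c • EllTwo.coherent z i) ⊗ₜ[ℂ] T (LTwo.bump 0)) := by
    intro i
    rw [coherentIsometry_apply, coherentIsometry_apply, map_smul, opTensor_coe_tmul,
      TensorProduct.sub_tmul, map_sub, smul_sub, ← TensorProduct.smul_tmul', map_smul, smul_smul,
      smul_apply, one_apply_eq_self, smul_eq_mul, mul_comm c v]
    rcases hT with rfl | rfl
    · rfl
    · simp
  simp only [e]
  rw [tendsto_zero_iff_norm_tendsto_zero] at h ⊢
  simp only [norm_smul, norm_coe_tmul]
  simpa using (h.mul_const ‖T (LTwo.bump 0)‖).const_mul ‖v‖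

lemma starIntertwines_opα :
    StarIntertwines atTop (coherentIsometry z) (opα q) ((z : ℂ) • 1) := by
  constructor
  · refine approxIntertwines_coherent (Or.inl rfl) ?_
    have h := ((EllTwo.shift.continuous.tendsto 0).comp (tendsto_opSqrt_coherent q z)).add
      (EllTwo.tendsto_shift_coherent z)
    simpa [Function.comp_def] using h
  · rw [opα, star_opTensor, star_mul, star_opSqrt, star_one, star_smul, star_one]
    refine approxIntertwines_coherent (Or.inl rfl) ?_
    have h := (((opSqrt q).continuous.tendsto 0).comp (EllTwo.tendsto_star_shift_coherent z)).add
      ((tendsto_opSqrt_coherent q z).const_smul (star (z : ℂ)))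
    simpa [Function.comp_def, smul_sub] using h

lemma root_lt_one {n : ℕ} (hn : n ≠ 0) : (root q n : ℝ) < 1 :=
  Real.rpow_lt_one q.2.1.le q.2.2 (by positivity)

lemma starIntertwines_opRoot {n : ℕ} (hn : n ≠ 0) :
    StarIntertwines atTop (coherentIsometry z) (opRoot q n) 0 := by
  have h := EllTwo.tendsto_powDiag_coherent z (root_lt_one q hn)
  rw [← zero_smul ℂ (1 : ℂ →L[ℂ] ℂ)]
  constructor
  · exact approxIntertwines_coherent (Or.inr rfl) (by simpa using h)
  · rw [opRoot, star_opTensor, star_powDiag, star_smul, star_zero, star_one]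
    exact approxIntertwines_coherent (Or.inr rfl) (by simpa using h)

end SUq

/-! ### Representations of the covering algebra -/

namespace SUq

/-- The generators `α` and `β` generate `C(SU_q(2))` topologically. -/
lemma mem_of_generators {q : ℝ} {D : StarSubalgebra ℂ (SUq q)} (hD : IsClosed (D : Set (SUq q)))
    (hα : α q ∈ D) (hβ : β q ∈ D) (a : SUq q) : a ∈ D := by
  have hgen : ∀ i, of q (FreeStarAlgebra.gen i) ∈ D := fun i => by
    cases i
    · exact hα
    · exact hβ
  refine (denseRange_of q).induction_on (p := fun a => a ∈ D) a hD fun x => ?_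
  induction x using FreeStarAlgebra.induction with
  | h0 c =>
    rw [AlgHomClass.commutes]
    exact algebraMap_mem D c
  | h1 y =>
    rcases y with ⟨x, _ | _⟩
    · exact hgen x
    · have hx : (FreeStarAlgebra.letter (x, true) : Free) = star (FreeStarAlgebra.gen x) :=
        (FreeStarAlgebra.star_letter (x, false)).symm
      rw [hx, map_star]
      exact star_mem (hgen x)
  | hm a b ha hb =>
    rw [map_mul]
    exact mul_mem ha hb
  | ha a b ha hb =>
    rw [map_add]
    exact add_mem ha hb

variable {q : Set.Ioo (0 : ℝ) 1} {n : ℕ}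

/-- The covering algebra is generated by `α` and the root of `β`. -/
lemma coverSubalgebra_le (hn : n ≠ 0) {D : StarSubalgebra ℂ (SUqSpace →L[ℂ] SUqSpace)}
    (hD : IsClosed (D : Set (SUqSpace →L[ℂ] SUqSpace))) (hα : opα q ∈ D) (hr : opRoot q n ∈ D) :
    coverSubalgebra q n ≤ D := by
  refine StarSubalgebra.topologicalClosure_minimal (StarAlgebra.adjoin_le ?_) hD
  rintro _ (⟨a, rfl⟩ | rfl)
  · refine mem_of_generators (D := D.comap (rep q))
      (hD.preimage (continuous_starAlgHom (rep q))) ?_ ?_ a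
    · change rep q (α q) ∈ D
      rwa [rep, lift_α]
    · change rep q (β q) ∈ D
      have h : opRoot q n ^ n = rep q (β q) := by
        have := congrArg (SUqCover.val q n) (SUqCover.root_pow q n hn)
        rwa [map_pow] at this
      rw [← h]
      exact pow_mem hr n
  · exact hr

end SUq

namespace SUqCover

variable {q : Set.Ioo (0 : ℝ) 1} {n : ℕ}

lemma val_root : val q n (root q n) = SUq.opRoot q n := rfl

lemma val_incl_α : val q n (incl q n (SUq.α q)) = SUq.opα q :=
  SUq.lift_α (SUq.op_relations q)

lemma val_incl_β : val q n (incl q n (SUq.β q)) = SUq.opβ q :=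
  SUq.lift_β (SUq.op_relations q)

lemma mem_of_generators (hn : n ≠ 0) {D : StarSubalgebra ℂ (SUqCover q n)}
    (hD : IsClosed (D : Set (SUqCover q n))) (hα : incl q n (SUq.α q) ∈ D)
    (hr : root q n ∈ D) (x : SUqCover q n) : x ∈ D := by
  have hi : Isometry (val q n) := AddMonoidHomClass.isometry_of_norm _ fun _ => rfl
  have hc : IsClosed (D.map (val q n) : Set (SUqSpace →L[ℂ] SUqSpace)) :=
    hi.isClosedEmbedding.isClosedMap _ hD
  obtain ⟨y, hy, e⟩ := SUq.coverSubalgebra_le hn hc ⟨_, hα, val_incl_α⟩ ⟨_, hr, val_root⟩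
    (val_mem q n x)
  rwa [← val_injective q n e]

section Induced

variable {ι : Type*} {l : Filter ι} [l.NeBot]
variable {K : Type*} [NormedAddCommGroup K] [InnerProductSpace ℂ K] [CompleteSpace K]
variable {V : ι → K →ₗᵢ[ℂ] SUqSpace} {A P : K →L[ℂ] K}

/-- The representation of the covering algebra that is asymptotically induced by isometries which
intertwine the generators. -/
def inducedRep (hn : n ≠ 0) (hα : StarIntertwines l V (SUq.opα q) A)
    (hr : StarIntertwines l V (SUq.opRoot q n) P) : SUqCover q n →⋆ₐ[ℂ] (K →L[ℂ] K) :=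
  (approxRep (l := l) V).comp (StarSubalgebra.inclusion
    (SUq.coverSubalgebra_le hn (isClosed_approxDomain (l := l) V) ⟨A, hα⟩ ⟨P, hr⟩))

lemma inducedRep_eq (hn : n ≠ 0) (hα : StarIntertwines l V (SUq.opα q) A)
    (hr : StarIntertwines l V (SUq.opRoot q n) P) {x : SUqCover q n} {S : K →L[ℂ] K}
    (h : StarIntertwines l V (val q n x) S) : inducedRep hn hα hr x = S :=
  approxRep_eq h

end Induced

/-- The representation of the covering algebra on `ℓ²(ℕ)` by evaluation at `0 ∈ ℝ`. -/
def evalRep (q : Set.Ioo (0 : ℝ) 1) (hn : n ≠ 0) : SUqCover q n →⋆ₐ[ℂ] (EllTwo →L[ℂ] EllTwo) :=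
  inducedRep hn (by rw [SUq.opα, ← LTwo.mulChar_zero]; exact starIntertwines_bump _ 0)
    (starIntertwines_bump (SUq.powDiag (SUq.root q n)) (1 / n))

lemma evalRep_incl_β (hn : n ≠ 0) : evalRep q hn (incl q n (SUq.β q)) = SUq.opQ q :=
  inducedRep_eq hn _ _ (by rw [val_incl_β]; exact starIntertwines_bump (SUq.opQ q) 1)

/-- The character of the covering algebra with `α ↦ z` and `β̃ ↦ 0`, as a representation on `ℂ`. -/
def character (q : Set.Ioo (0 : ℝ) 1) (hn : n ≠ 0) (z : Circle) :
    SUqCover q n →⋆ₐ[ℂ] (ℂ →L[ℂ] ℂ) :=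
  inducedRep hn (SUq.starIntertwines_opα q z) (SUq.starIntertwines_opRoot q z hn)

lemma character_incl_α (hn : n ≠ 0) (z : Circle) :
    character q hn z (incl q n (SUq.α q)) = (z : ℂ) • 1 :=
  inducedRep_eq hn _ _ (by rw [val_incl_α]; exact SUq.starIntertwines_opα q z)

lemma character_root (hn : n ≠ 0) (z : Circle) : character q hn z (root q n) = 0 :=
  inducedRep_eq hn _ _ (SUq.starIntertwines_opRoot q z hn)

lemma character_incl_β (hn : n ≠ 0) (z : Circle) :
    character q hn z (incl q n (SUq.β q)) = 0 := by
  rw [← root_pow q n hn, map_pow, character_root, zero_pow hn]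

lemma continuous_character (hn : n ≠ 0) (x : SUqCover q n) :
    Continuous fun z => character q hn z x := by
  refine mem_of_generators hn (D := continuousStarSubalgebra (character q hn))
    (isClosed_continuousStarSubalgebra _) ?_ ?_ x
  · change Continuous fun z => character q hn z _
    simp only [character_incl_α]
    fun_prop
  · change Continuous fun z => character q hn z _
    simp only [character_root]
    exact continuous_const

end SUqCover

/-! ### Representations of the minimal tensor product -/

namespace MinTensor

variable {A B : Type} [CStarAlgebra A] [CStarAlgebra B]
variable {H K : Type} [NormedAddCommGroup H] [InnerProductSpace ℂ H] [CompleteSpace H]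
  [NormedAddCommGroup K] [InnerProductSpace ℂ K] [CompleteSpace K]

/-- The representation `π ⊗ ρ` of the minimal tensor product. -/
def rep (π : A →⋆ₐ[ℂ] (H →L[ℂ] H)) (ρ : B →⋆ₐ[ℂ] (K →L[ℂ] K)) :
    MinTensor A B →⋆ₐ[ℂ] (HilbertTensor H K →L[ℂ] HilbertTensor H K) :=
  CStarSeminorm.Compl.lift (minSeminorm A B) (repTensor π ρ) fun x =>
    CStarSeminorm.le_sup (spatialSeminorms_bddAbove A B)
      (p := CStarSeminorm.ofHom (repTensor π ρ)) ⟨H, K, _, _, _, _, _, _, π, ρ, rfl⟩ x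

lemma rep_of (π : A →⋆ₐ[ℂ] (H →L[ℂ] H)) (ρ : B →⋆ₐ[ℂ] (K →L[ℂ] K)) (x : A ⊗[ℂ] B) :
    rep π ρ (of x) = repTensor π ρ x :=
  CStarSeminorm.Compl.lift_coe (minSeminorm A B) _ _ x

lemma rep_tmul (π : A →⋆ₐ[ℂ] (H →L[ℂ] H)) (ρ : B →⋆ₐ[ℂ] (K →L[ℂ] K)) (a : A) (b : B) :
    rep π ρ (tmul a b) = opTensor (π a) (ρ b) :=
  rep_of π ρ _

lemma continuous_rep {Z : Type*} [TopologicalSpace Z] (π : A →⋆ₐ[ℂ] (H →L[ℂ] H))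
    {ρ : Z → B →⋆ₐ[ℂ] (K →L[ℂ] K)} (hρ : ∀ b, Continuous fun z => ρ z b) (x : MinTensor A B) :
    Continuous fun z => rep π (ρ z) x := by
  refine denseRange_of.induction_on (p := fun x => x ∈ continuousStarSubalgebra
    fun z => rep π (ρ z)) x (isClosed_continuousStarSubalgebra _) fun y => ?_
  change Continuous fun z => rep π (ρ z) (of y)
  simp only [rep_of]
  induction y using TensorProduct.induction_on with
  | zero => simpa only [map_zero] using continuous_const
  | add y y' h h' =>
    simp only [map_add]
    exact h.add h'
  | tmul a b =>
    simp only [repTensor_tmul]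
    let f : (K →L[ℂ] K) →ₗ[ℂ] (HilbertTensor H K →L[ℂ] HilbertTensor H K) :=
      { toFun := opTensor (π a)
        map_add' := opTensor_add_right (π a)
        map_smul' := fun c => opTensor_smul_right c (π a) }
    have hf : Continuous f :=
      AddMonoidHomClass.continuous_of_bound f ‖π a‖ fun T => norm_opTensor_le _ _
    exact hf.comp (hρ b)

end MinTensor

/-! ### The ground state of `Q` -/

namespace SUq

variable (q : Set.Ioo (0 : ℝ) 1)

/-- The unit vector `e_0`. -/
def ground : EllTwo := lp.single 2 0 (1 : ℂ)

lemma ground_zero : ground 0 = 1 := lp.single_apply_self 2 0 1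

lemma ground_succ (k : ℕ) : ground (k + 1) = 0 := lp.single_apply_ne 2 0 1 (Nat.succ_ne_zero k)

lemma opQ_ground : opQ q ground = ground := by
  ext k
  change (((q : ℝ) ^ k : ℝ) : ℂ) * ground k = ground k
  cases k
  · simp
  · simp [ground_succ]

/-- The projection onto the span of `e_0`, as the diagonal operator `e_k ↦ 0 ^ k e_k`, where
`0 ^ 0 = 1`. -/
def groundProj : EllTwo →L[ℂ] EllTwo := powDiag ⟨0, le_rfl, zero_le_one⟩

lemma groundProj_apply (f : EllTwo) : groundProj f = f 0 • ground := by
  ext k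
  change (((0 : ℝ) ^ k : ℝ) : ℂ) * f k = f 0 * ground k
  cases k
  · simp [ground_zero]
  · simp [ground_succ]

lemma norm_opQ_sub_groundProj_le : ‖opQ q - groundProj‖ ≤ q := by
  refine ContinuousLinearMap.opNorm_le_bound _ q.2.1.le fun f => ?_
  have h : ‖((q : ℝ) : ℂ) • f‖ = q * ‖f‖ := by
    rw [norm_smul, Complex.norm_real, Real.norm_of_nonneg q.2.1.le]
  rw [← h]
  refine lp.norm_mono two_ne_zero fun k => ?_
  change ‖(((q : ℝ) ^ k : ℝ) : ℂ) * f k - (((0 : ℝ) ^ k : ℝ) : ℂ) * f k‖ ≤ ‖((q : ℝ) : ℂ) * f k‖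
  rcases k with _ | k
  · rw [pow_zero, pow_zero, sub_self, norm_zero]
    exact norm_nonneg _
  · rw [zero_pow k.succ_ne_zero, Complex.ofReal_zero, zero_mul, sub_zero, norm_mul, norm_mul,
      Complex.norm_real, Complex.norm_real, Real.norm_of_nonneg q.2.1.le,
      Real.norm_of_nonneg (pow_nonneg q.2.1.le _)]
    gcongr
    exact pow_le_of_le_one q.2.1.le q.2.2.le k.succ_ne_zero

lemma opQ_sub_groundProj_mul : (opQ q - groundProj) * groundProj = 0 := by
  ext1 f
  rw [mul_apply_eq_comp, groundProj_apply, map_smul, sub_apply, opQ_ground, groundProj_apply,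
    ground_zero, one_smul, sub_self, smul_zero]
  rfl

/-- The unit vector `e_0 ⊗ 1` of `ℓ²(ℕ) ⊗ ℂ`. -/
def vacuum : HilbertTensor EllTwo ℂ := coe (ground ⊗ₜ[ℂ] 1)

lemma norm_ground : ‖ground‖ = 1 := by
  rw [ground, lp.norm_single (by norm_num), norm_one]

lemma norm_vacuum : ‖vacuum‖ = 1 := by
  rw [vacuum, norm_coe_tmul, norm_ground, norm_one, mul_one]

lemma opTensor_opQ_vacuum : opTensor (opQ q) 1 vacuum = vacuum := by
  rw [vacuum, opTensor_coe_tmul, opQ_ground]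
  rfl

lemma opTensor_groundProj_mem (u : HilbertTensor EllTwo ℂ) :
    opTensor groundProj 1 u ∈ ℂ ∙ vacuum := by
  induction u using HilbertTensor.induction_on with
  | hc => exact (Submodule.closed_of_finiteDimensional (ℂ ∙ vacuum)).preimage (by fun_prop)
  | h x =>
    induction x using TensorProduct.induction_on with
    | zero =>
      rw [map_zero, map_zero]
      exact zero_mem _
    | add x y hx hy =>
      rw [map_add, map_add]
      exact add_mem hx hy
    | tmul f c =>
      refine Submodule.mem_span_singleton.2 ⟨f 0 * c, ?_⟩
      rw [opTensor_coe_tmul, groundProj_apply, one_apply_eq_self, vacuum, ← map_smul]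
      congr 1
      rw [TensorProduct.smul_tmul', mul_comm, mul_smul, ← TensorProduct.smul_tmul',
        ← TensorProduct.tmul_smul, smul_eq_mul, mul_one]

/-- The eigenvalue `1` of `Q` is simple: the rest of the spectrum of `Q` is bounded by `q`. -/
lemma mem_span_vacuum {u : HilbertTensor EllTwo ℂ} (h : opTensor (opQ q) 1 u = u) :
    u ∈ ℂ ∙ vacuum := by
  have hQ : opTensor (opQ q) (1 : ℂ →L[ℂ] ℂ) =
      opTensor (opQ q - groundProj) 1 + opTensor groundProj 1 := by
    rw [← opTensor_add_left, sub_add_cancel]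
  have h0 : opTensor (opQ q - groundProj) (1 : ℂ →L[ℂ] ℂ) (opTensor groundProj 1 u) = 0 := by
    rw [← mul_apply_eq_comp, opTensor_mul, opQ_sub_groundProj_mul]
    have := opTensor_smul_left (0 : ℂ) (0 : EllTwo →L[ℂ] EllTwo) (1 * 1 : ℂ →L[ℂ] ℂ)
    rw [zero_smul, zero_smul] at this
    rw [this]
    rfl
  set T := opTensor (opQ q - groundProj) (1 : ℂ →L[ℂ] ℂ)
  set P := opTensor groundProj (1 : ℂ →L[ℂ] ℂ)
  have h1 : T (u - P u) = u - P u := by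
    rw [map_sub, h0, sub_zero, eq_sub_iff_add_eq]
    rw [hQ] at h
    exact h
  have h2 : ‖T‖ ≤ q := by
    refine (norm_opTensor_le _ _).trans ?_
    rw [norm_one, mul_one]
    exact norm_opQ_sub_groundProj_le q
  have h3 : ‖u - P u‖ ≤ q * ‖u - P u‖ := by
    conv_lhs => rw [← h1]
    exact T.le_of_opNorm_le h2 _
  have h4 : ‖u - P u‖ = 0 := by
    have := q.2.2
    nlinarith [norm_nonneg (u - P u)]
  rw [sub_eq_zero.1 (norm_eq_zero.1 h4)]
  exact opTensor_groundProj_mem u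

end SUq

/-! ### The obstruction -/

namespace SUqCover

variable {q : Set.Ioo (0 : ℝ) 1} {n : ℕ}

/-- No ⋆-homomorphism `Δ'` on the covering algebra has the value `Δ(β)` at `β`: under
`evalRep ⊗ character z`, the element `Δ'(β̃)` would become an `n`-th root of `z Q`, and its
eigenvalue at `e_0` would be an `n`-th root of `z` that is continuous in `z`. -/
lemma not_extends_comul (hn : 2 ≤ n)
    (Δ' : SUqCover q n →⋆ₐ[ℂ] MinTensor (SUqCover q n) (SUqCover q n))
    (h : Δ' (incl q n (SUq.β q)) =
      MinTensor.map (incl q n) (incl q n) (SUq.comul q (SUq.β q))) : False := by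
  have hn0 : n ≠ 0 := by omega
  let y : Circle → HilbertTensor EllTwo ℂ →L[ℂ] HilbertTensor EllTwo ℂ := fun z =>
    MinTensor.rep (evalRep q hn0) (character q hn0 z) (Δ' (root q n))
  have hy : Continuous y := MinTensor.continuous_rep _ (continuous_character hn0) _
  have hpow : ∀ z, y z ^ n = (z : ℂ) • opTensor (SUq.opQ q) 1 := fun z => by
    have hz : ∀ S : EllTwo →L[ℂ] EllTwo, opTensor S (0 : ℂ →L[ℂ] ℂ) = 0 := fun S => by
      simpa only [zero_smul] using opTensor_smul_right (0 : ℂ) S (0 : ℂ →L[ℂ] ℂ)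
    change (MinTensor.rep _ _ _) ^ n = _
    rw [← map_pow, ← map_pow, root_pow q n hn0, h, SUq.comul_β, map_add, MinTensor.map_tmul,
      MinTensor.map_tmul, map_add, MinTensor.rep_tmul, MinTensor.rep_tmul, character_incl_β, hz,
      add_zero, evalRep_incl_β, character_incl_α, opTensor_smul_right]
  have heig : ∀ z, ∃ c : ℂ, c • SUq.vacuum = y z SUq.vacuum := fun z => by
    refine Submodule.mem_span_singleton.1 (SUq.mem_span_vacuum q ?_)
    -- `y z` commutes with its own power `z Q`, so it preserves the simple eigenspace of `e_0`
    have hcomm : y z ^ n * y z = y z * y z ^ n := ((Commute.refl (y z)).pow_left n).eq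
    have h1 := congrArg (fun T => T SUq.vacuum) hcomm
    simp only [hpow, mul_apply_eq_comp, smul_apply, map_smul, SUq.opTensor_opQ_vacuum] at h1
    exact smul_right_injective _ (Circle.coe_ne_zero z) h1
  choose c hc using heig
  have hinner : ∀ z, c z = inner ℂ SUq.vacuum (y z SUq.vacuum) := fun z => by
    rw [← hc, inner_smul_right, inner_self_eq_norm_sq_to_K, SUq.norm_vacuum]
    simp
  have hcc : Continuous c := by
    rw [funext hinner]
    fun_prop
  refine not_continuous_root_circle hn hcc fun z => ?_
  have hk : ∀ k, (y z ^ k) SUq.vacuum = c z ^ k • SUq.vacuum := fun k => by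
    induction k with
    | zero => simp
    | succ k ih => rw [pow_succ, mul_apply_eq_comp, ← hc, map_smul, ih, smul_smul, pow_succ']
  have h1 := hk n
  rw [hpow, smul_apply, SUq.opTensor_opQ_vacuum] at h1
  have h2 : SUq.vacuum ≠ 0 := norm_ne_zero_iff.1 (by rw [SUq.norm_vacuum]; exact one_ne_zero)
  exact (smul_left_injective ℂ h2 h1).symm

end SUqCover

end

theorem mainTheorem3 (q : Set.Ioo (0 : ℝ) 1) (n : ℕ) (hn : 2 ≤ n) :
    ¬ ∃ Δ' : SUqCover q n →⋆ₐ[ℂ] MinTensor (SUqCover q n) (SUqCover q n),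
      IsCompactQuantumGroup Δ' ∧
      (∀ a : SUq q, Δ' (SUqCover.incl q n a) =
        MinTensor.map (SUqCover.incl q n) (SUqCover.incl q n) (SUq.comul q a)) ∧
      (∀ (g : ZMod n) (x : SUqCover q n), Δ' (SUqCover.deck q n g x) =
        MinTensor.map (SUqCover.deck q n g) (SUqCover.deck q n g) (Δ' x)) := by
  rintro ⟨Δ', -, h, -⟩
  exact SUqCover.not_extends_comul hn Δ' (h _)
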